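/- Let $X$ be a smooth manifold of dimension $n$ with a smooth Riemannian metric, let $p\ge 1$, and let $\phi$ be a calibration of degree $p$ on $X$, i.e. a smooth closed $p$-form with $\phi(\xi)\le 1$ for every unit simple $p$-vector $\xi$ tangent to $X$. Let $G(\phi)$ be the set of $\phi$-planes, i.e. of the unit simple $p$-vectors $\xi$ with $\phi(\xi)=1$. For $f\in C^\infty(X)$ put $d^\phi f=\nabla f\,\lrcorner\,\phi=\phi(\nabla f,\cdot,\dots,\cdot)$, and call $f$ *$\phi$-pluriharmonic mod $d$* if $$dd^\phi f = df\wedge\alpha+\sigma$$ for some smooth $(p-1)$-form $\alpha$ and some smooth $p$-form $\sigma$ on $X$ with $\sigma(\xi)=0$ for all $\xi\in G(\phi)$. **Corollary 5.5.** Let $M$ be a compact $\phi$-submanifold of $X$ with boundary $\Gamma$, that is, a compact smoothly embedded oriented $p$-dimensional submanifold with boundary whose oriented tangent space at every point is a $\phi$-plane. Assume that every connected component of $M$ meets $\Gamma$. Then for every function $f\in C^\infty(X)$ that is $\phi$-pluriharmonic mod $d$, $f$ is bounded on $\Gamma$ and $$\inf_\Gamma f\ \le\ f(x)\ \le\ \sup_\Gamma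 f\qquad\text{for all } x\in M.$$ -/

import Mathlib

open scoped Manifold ContDiff Topology

noncomputable section

namespace Calibrated

/-- The model space `ℝⁿ`. -/
abbrev Euc (n : ℕ) := EuclideanSpace ℝ (Fin n)

section Forms

variable {n : ℕ} {X : Type*} [TopologicalSpace X] [ChartedSpace (Euc n) X]

/-- (Not necessarily smooth) exterior `p`-forms on the `n`-manifold `X`. -/
abbrev Form (n : ℕ) (X : Type*) [TopologicalSpace X] [ChartedSpace (Euc n) X] (p : ℕ) :=
  ∀ x : X, (TangentSpace (𝓡 n) x) [⋀^Fin p]→L[ℝ] ℝ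

/-- The expression of `η` in the preferred chart of `X` around `x₀`: the pull-back of `η` under the
inverse of that chart, a form on (the target of the chart in) `ℝⁿ`. -/
def formInChart {p : ℕ} (η : Form n X p) (x₀ : X) (y : Euc n) : (Euc n) [⋀^Fin p]→L[ℝ] ℝ :=
  (η ((extChartAt (𝓡 n) x₀).symm y)).compContinuousLinearMap
    (mfderiv 𝓘(ℝ, Euc n) (𝓡 n) (extChartAt (𝓡 n) x₀).symm y)

/-- A form is smooth if it has smooth coefficients in the charts of `X`. -/
def IsSmoothForm {p : ℕ} (η : Form n X p) : Prop :=
  ∀ x₀ : X, ContDiffOn ℝ ∞ (formInChart η x₀) (extChartAt (𝓡 n) x₀).target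

/-- The exterior derivative `dη`, computed in the preferred chart around `x` and pulled back by it. -/
def extD {p : ℕ} (η : Form n X p) : Form n X (p + 1) := fun x =>
  (extDeriv (formInChart η x) (extChartAt (𝓡 n) x x)).compContinuousLinearMap
    (mfderiv (𝓡 n) 𝓘(ℝ, Euc n) (extChartAt (𝓡 n) x) x)

/-- The contraction `v ⌟ η = η(v, ⬝, …, ⬝)` with a vector field `v`. -/
def contract {p : ℕ} (v : ∀ x : X, TangentSpace (𝓡 n) x) (η : Form n X (p + 1)) :
    Form n X p := fun x =>
  ContinuousAlternatingMap.curryLeft (E := Euc n) (η x) (v x)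

/-- The differential `df(x)` of a real function, as a linear form on the tangent space. -/
def differential (f : X → ℝ) (x : X) : TangentSpace (𝓡 n) x →L[ℝ] ℝ :=
  mfderiv (𝓡 n) 𝓘(ℝ, ℝ) f x

/-- The wedge product `df ∧ α` of the differential of a function with a `p`-form:
`(df ∧ α)(v₀, …, v_p) = ∑ᵢ (-1)ⁱ df(vᵢ) α(v₀, …, v̂ᵢ, …, v_p)`. -/
def dWedge {p : ℕ} (f : X → ℝ) (α : Form n X p) : Form n X (p + 1) := fun x =>
  ContinuousAlternatingMap.alternatizeUncurryFin (E := Euc n)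
    (ContinuousLinearMap.smulRight (M₁ := Euc n) (differential f x) (α x))

theorem contract_apply {p : ℕ} (v : ∀ x : X, TangentSpace (𝓡 n) x) (η : Form n X (p + 1))
    (x : X) (w : Fin p → TangentSpace (𝓡 n) x) :
    contract v η x w = η x (Fin.cons (v x) w) := rfl

theorem dWedge_apply {p : ℕ} (f : X → ℝ) (α : Form n X p) (x : X)
    (w : Fin (p + 1) → TangentSpace (𝓡 n) x) :
    dWedge f α x w = ∑ i : Fin (p + 1), (-1 : ℝ) ^ (i : ℕ) *
      (differential f x (w i) * α x (i.removeNth w)) := by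
  unfold dWedge
  erw [ContinuousAlternatingMap.alternatizeUncurryFin_apply]
  refine Finset.sum_congr rfl fun i _ => ?_
  rw [zsmul_eq_mul]
  push_cast
  rfl

end Forms

section Calibrations

variable {n : ℕ} {X : Type*} [TopologicalSpace X] [ChartedSpace (Euc n) X]
  [IsManifold (𝓡 n) ∞ X]

/-- Smooth Riemannian metrics on the `n`-manifold `X`. -/
abbrev Metric (n : ℕ) (X : Type*) [TopologicalSpace X] [ChartedSpace (Euc n) X]
    [IsManifold (𝓡 n) ∞ X] :=
  Bundle.ContMDiffRiemannianMetric (𝓡 n) ∞ (Euc n) (fun x : X => TangentSpace (𝓡 n) x)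

/-- `v` is an orthonormal family of tangent vectors at `x`. The unit simple `p`-vectors at `x` are
exactly the `v₁ ∧ ⋯ ∧ v_p` with `v` orthonormal. -/
def IsOrthonormal (g : Metric n X) (x : X) {p : ℕ} (v : Fin p → TangentSpace (𝓡 n) x) : Prop :=
  ∀ i j, g.inner x (v i) (v j) = if i = j then 1 else 0

theorem exists_gradient (g : Metric n X) (x : X) (l : TangentSpace (𝓡 n) x →L[ℝ] ℝ) :
    ∃ v : TangentSpace (𝓡 n) x, ∀ w, g.inner x v w = l w := by
  have : FiniteDimensional ℝ (TangentSpace (𝓡 n) x) :=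
    inferInstanceAs (FiniteDimensional ℝ (Euc n))
  let B : TangentSpace (𝓡 n) x →ₗ[ℝ] Module.Dual ℝ (TangentSpace (𝓡 n) x) :=
    { toFun := fun v => (g.inner x v : TangentSpace (𝓡 n) x →ₗ[ℝ] ℝ)
      map_add' := fun v w => by ext; simp
      map_smul' := fun c v => by ext; simp }
  have hinj : Function.Injective B := by
    rw [← LinearMap.ker_eq_bot, LinearMap.ker_eq_bot']
    intro v hv
    by_contra hne
    have h := g.pos x v hne
    have h0 : g.inner x v v = 0 := LinearMap.congr_fun hv v
    exact absurd h0 h.ne'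
  have hsurj : Function.Surjective B :=
    (LinearMap.injective_iff_surjective_of_finrank_eq_finrank
      (Subspace.dual_finrank_eq).symm).1 hinj
  obtain ⟨v, hv⟩ := hsurj (l : TangentSpace (𝓡 n) x →ₗ[ℝ] ℝ)
  exact ⟨v, fun w => LinearMap.congr_fun hv w⟩

/-- The Riemannian gradient `∇f`, characterized by `⟨∇f, w⟩ = df(w)`. -/
def gradient (g : Metric n X) (f : X → ℝ) (x : X) : TangentSpace (𝓡 n) x :=
  Classical.choose (exists_gradient g x (differential f x))

theorem inner_gradient (g : Metric n X) (f : X → ℝ) (x : X) (w : TangentSpace (𝓡 n) x) :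
    g.inner x (gradient g f x) w = differential f x w :=
  Classical.choose_spec (exists_gradient g x (differential f x)) w

/-- `φ` is a calibration on `(X, g)`: a smooth closed `p`-form of comass one, that is, with
`φ(ξ) ≤ 1` for every unit simple `p`-vector `ξ`. -/
structure IsCalibration (g : Metric n X) {p : ℕ} (φ : Form n X p) : Prop where
  smooth : IsSmoothForm φ
  closed : extD φ = 0
  comass_le : ∀ (x : X) (v : Fin p → TangentSpace (𝓡 n) x), IsOrthonormal g x v → φ x v ≤ 1

/-- `v₁ ∧ ⋯ ∧ v_p` is a `φ`-plane at `x` (an element of `G(φ)`), given by an oriented orthonormal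
basis `v`. -/
def IsPhiPlane (g : Metric n X) {p : ℕ} (φ : Form n X p) (x : X)
    (v : Fin p → TangentSpace (𝓡 n) x) : Prop :=
  IsOrthonormal g x v ∧ φ x v = 1

/-- The operator `d^φ f = ∇f ⌟ φ`. -/
def dPhi (g : Metric n X) {q : ℕ} (φ : Form n X (q + 1)) (f : X → ℝ) : Form n X q :=
  contract (gradient g f) φ

/-- The smooth function `f` is `φ`-pluriharmonic mod `d`: `dd^φ f = df ∧ α + σ` for a smooth form
`α` and a smooth form `σ` that vanishes on all `φ`-planes. -/
def IsPluriharmonicModD (g : Metric n X) {q : ℕ} (φ : Form n X (q + 1)) (f : X → ℝ) : Prop :=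
  ContMDiff (𝓡 n) 𝓘(ℝ, ℝ) ∞ f ∧
  ∃ (α : Form n X q) (σ : Form n X (q + 1)), IsSmoothForm α ∧ IsSmoothForm σ ∧
    (∀ x v, IsPhiPlane g φ x v → σ x v = 0) ∧
    extD (dPhi g φ f) = dWedge f α + σ

/-- The map `ι : M → X` exhibits the manifold with boundary `M` as a `φ`-submanifold with boundary
of `X`: it is a smooth embedding, and at each point of `M` the tangent space of `M` has an
orthonormal basis `ι_* e` that spans a `φ`-plane. (As `φ` is a continuous form and
`φ(-ξ) = -φ(ξ)`, these bases define an orientation of `M`, the one for which the oriented tangent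
spaces are `φ`-planes.) -/
structure IsPhiSubmanifold (g : Metric n X) {q : ℕ} (φ : Form n X (q + 1))
    {M : Type*} [TopologicalSpace M] [ChartedSpace (EuclideanHalfSpace (q + 1)) M]
    (ι : M → X) : Prop where
  isSmoothEmbedding : Manifold.IsSmoothEmbedding (𝓡∂ (q + 1)) (𝓡 n) ∞ ι
  tangent : ∀ m : M, ∃ e : Fin (q + 1) → TangentSpace (𝓡∂ (q + 1)) m,
    IsPhiPlane g φ (ι m) (fun i => mfderiv (𝓡∂ (q + 1)) (𝓡 n) ι m (e i))

end Calibrations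

end Calibrated

end

noncomputable section

namespace Calibrated

set_option maxSynthPendingDepth 3

/-! ### Hopf's strong maximum principle for second order differential inequalities -/

section MaximumPrinciple

open Metric Set Filter

/-! Along `M` the calibration attains its largest possible value on unit simple vectors. Hence `φ`
vanishes on a tangent frame in which one vector is replaced by a normal one (the first cousin
principle, `map_update_eq_zero_of_orthogonal`). So in the restriction of `∇f ⌟ φ` to `M` only the
tangential part of `∇f` counts, which is the intrinsic gradient of `u = f|_M`. The restriction of
`dd^φ f` is therefore the Laplacian of `u` times the volume form. Since `σ` vanishes on tangent
planes, `Δu · vol = du ∧ α` on `M`: an elliptic equation without zeroth order term. By the strong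
maximum principle `u` is locally constant near each interior local extremum. If the maximum set of a
component missed `Γ`, it would be open and closed, hence the whole component, which does meet `Γ`.

The Laplacian itself is never formed. In an interior chart, with `Φ` the pulled back calibration and
`w` the gradient of `u`, a calibrated frame `e` satisfies `∑ D²u(eᵢ, eᵢ) = d(w ⌟ Φ)(e) +` terms
linear in `w` (`sum_fderiv_fderiv_eq`), whence `|∑ D²u(eᵢ, eᵢ)| ≤ C ‖Du‖`
(`exists_elliptic_inequality`). The maximum principle `eq_of_isMax_of_elliptic` is set up for such
inequalities: the frame may be chosen separately at each point, without continuity, as long as its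
size and ellipticity are uniformly controlled. -/

theorem fderiv_fderiv_nonpos_of_isLocalMax {E : Type*} [NormedAddCommGroup E] [NormedSpace ℝ E]
    {w : E → ℝ} {x : E} (hw : ContDiffAt ℝ 2 w x) (hmax : IsLocalMax w x) (e : E) :
    fderiv ℝ (fderiv ℝ w) x e e ≤ 0 := by
  by_contra! hpos
  let l : ℝ → E := fun t => x + t • e
  have hl0 : l 0 = x := by simp [l]
  have hl : ∀ t, HasDerivAt l e t := fun t => by
    have h := ((hasDerivAt_id t).smul_const e).const_add x
    rw [one_smul] at h
    exact h
  have hlc : ContinuousAt l 0 := (hl 0).continuousAt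
  have hdiff : ∀ᶠ z in 𝓝 x, DifferentiableAt ℝ w z :=
    (hw.eventually (by simp)).mono fun z hz => hz.differentiableAt (by norm_num)
  have hd1 : ∀ᶠ t in 𝓝 (0 : ℝ), deriv (w ∘ l) t = fderiv ℝ w (l t) e := by
    have : ∀ᶠ t in 𝓝 (0 : ℝ), DifferentiableAt ℝ w (l t) := by
      have h := hlc.tendsto
      rw [hl0] at h
      exact h.eventually hdiff
    filter_upwards [this] with t ht
    exact (ht.hasFDerivAt.comp_hasDerivAt t (hl t)).deriv
  have hD2 : DifferentiableAt ℝ (fderiv ℝ w) x :=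
    (hw.fderiv_right (m := 1) (by norm_num)).differentiableAt (by norm_num)
  have hd2 : deriv (deriv (w ∘ l)) 0 = fderiv ℝ (fderiv ℝ w) x e e := by
    rw [Filter.EventuallyEq.deriv_eq hd1]
    have h : HasFDerivAt (fderiv ℝ w) (fderiv ℝ (fderiv ℝ w) x) (l 0) := by
      rw [hl0]; exact hD2.hasFDerivAt
    have h2 := (h.comp_hasDerivAt 0 (hl 0)).clm_apply (hasDerivAt_const (0 : ℝ) e)
    simpa using h2.deriv
  have hlocmax : IsLocalMax (w ∘ l) 0 := by
    have h := hlc.tendsto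
    rw [hl0] at h
    have := h.eventually hmax
    simpa [IsLocalMax, IsMaxFilter, hl0] using this
  have hcont : ContinuousAt (w ∘ l) 0 := by
    refine ContinuousAt.comp ?_ hlc
    rw [hl0]; exact hw.continuousAt
  -- By the second derivative test the maximum would also be a minimum, so `w ∘ l` would be locally
  -- constant and its second derivative zero.
  have hlocmin : IsLocalMin (w ∘ l) 0 :=
    isLocalMin_of_deriv_deriv_pos (by rw [hd2]; exact hpos) hlocmax.deriv_eq_zero hcont
  have hconst : (w ∘ l) =ᶠ[𝓝 0] fun _ => (w ∘ l) 0 := by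
    filter_upwards [hlocmax, hlocmin] with t h1 h2 using le_antisymm h1 h2
  have h0 : deriv (deriv (w ∘ l)) 0 = 0 := by
    have : deriv (w ∘ l) =ᶠ[𝓝 0] fun _ => 0 := by
      filter_upwards [hconst.deriv] with t ht
      rw [ht]; simp
    rw [this.deriv_eq]; simp
  rw [hd2] at h0
  exact hpos.ne' h0

variable {E : Type*} [NormedAddCommGroup E] [InnerProductSpace ℝ E]

/-- The function `x ↦ exp (-a ‖x - c‖²)` used as a barrier. -/
def gaussianBarrier (a : ℝ) (c x : E) : ℝ := Real.exp (-a * ‖x - c‖ ^ 2)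

theorem contDiff_gaussianBarrier (a : ℝ) (c : E) : ContDiff ℝ 2 (gaussianBarrier a c) := by
  unfold gaussianBarrier
  exact (contDiff_const.mul ((contDiff_id.sub contDiff_const).norm_sq ℝ)).exp

theorem hasFDerivAt_gaussianBarrier (a : ℝ) (c x : E) :
    HasFDerivAt (gaussianBarrier a c)
      ((-2 * a * gaussianBarrier a c x) • innerSL ℝ (x - c)) x := by
  have h1 : HasFDerivAt (fun x : E => ‖x - c‖ ^ 2) (2 • (innerSL ℝ (x - c))) x := by
    have := ((hasFDerivAt_id (𝕜 := ℝ) x).sub_const c).norm_sq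
    simpa using this
  have h2 := (h1.const_mul (-a)).exp
  refine h2.congr_fderiv ?_
  ext v
  simp [gaussianBarrier]
  ring

theorem fderiv_fderiv_gaussianBarrier (a : ℝ) (c x e : E) :
    fderiv ℝ (fderiv ℝ (gaussianBarrier a c)) x e e =
      gaussianBarrier a c x * (4 * a ^ 2 * inner ℝ e (x - c) ^ 2 - 2 * a * ‖e‖ ^ 2) := by
  have h : fderiv ℝ (gaussianBarrier a c) =
      fun x => (-2 * a * gaussianBarrier a c x) • innerSL ℝ (x - c) :=
    funext fun x => (hasFDerivAt_gaussianBarrier a c x).fderiv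
  have h1 := (hasFDerivAt_gaussianBarrier a c x).const_mul (-2 * a)
  have h2 : HasFDerivAt (fun x : E => innerSL ℝ (x - c)) (innerSL ℝ : E →L[ℝ] E →L[ℝ] ℝ) x :=
    (innerSL ℝ : E →L[ℝ] E →L[ℝ] ℝ).hasFDerivAt.comp x ((hasFDerivAt_id x).sub_const c)
  have h3 := h1.smul h2
  have h4 : fderiv ℝ (fun x => (-2 * a * gaussianBarrier a c x) • innerSL ℝ (x - c)) x = _ :=
    h3.fderiv
  rw [h, h4]
  have h5 : (innerSL ℝ e) e = ‖e‖ ^ 2 := by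
    rw [innerSL_apply_apply, real_inner_self_eq_norm_sq]
  have h6 : (innerSL ℝ (x - c)) e = inner ℝ e (x - c) := by
    rw [innerSL_apply_apply, real_inner_comm]
  simp only [add_apply, smul_apply, ContinuousLinearMap.smulRight_apply, smul_eq_mul, h5, h6]
  ring

/-- At a point where `u + ε v`, with `v` a sufficiently steep barrier, has a local maximum, `u` does
not satisfy the differential inequality `∑ D²u(eᵢ, eᵢ) ≥ -C ‖Du‖`. -/
theorem not_isLocalMax_add_gaussianBarrier {ι : Type*} [Fintype ι] {u : E → ℝ} {x c : E}
    {a ε l L C : ℝ} (hε : 0 < ε) (ha : 0 < a)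
    (hu : ContDiffAt ℝ 2 u x) (e : ι → E) (he : ∀ i, ‖e i‖ ≤ L)
    (hell : ∀ ξ : E, l * ‖ξ‖ ^ 2 ≤ ∑ i, inner ℝ (e i) ξ ^ 2)
    (hL : -(C * ‖fderiv ℝ u x‖) ≤ ∑ i, fderiv ℝ (fderiv ℝ u) x (e i) (e i))
    (hal : Fintype.card ι * L ^ 2 + C * ‖x - c‖ < 2 * a * l * ‖x - c‖ ^ 2) :
    ¬ IsLocalMax (fun y => u y + ε * gaussianBarrier a c y) x := by
  intro hmax
  set v := gaussianBarrier a c with hv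
  have hvx : 0 < v x := Real.exp_pos _
  have hvC : ContDiffAt ℝ 2 v x := (contDiff_gaussianBarrier a c).contDiffAt
  have hwC : ContDiffAt ℝ 2 (fun y => u y + ε * v y) x := hu.add (contDiffAt_const.mul hvC)
  have hd : ∀ᶠ y in 𝓝 x, fderiv ℝ (fun y => u y + ε * v y) y =
      fderiv ℝ u y + ε • fderiv ℝ v y := by
    filter_upwards [hu.eventually (by simp), hvC.eventually (by simp)] with y h1 h2
    exact ((h1.differentiableAt (by norm_num)).hasFDerivAt.add
      ((h2.differentiableAt (by norm_num)).hasFDerivAt.const_mul ε)).fderiv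
  have hDu : DifferentiableAt ℝ (fderiv ℝ u) x :=
    (hu.fderiv_right (m := 1) (by norm_num)).differentiableAt (by norm_num)
  have hDv : DifferentiableAt ℝ (fderiv ℝ v) x :=
    (hvC.fderiv_right (m := 1) (by norm_num)).differentiableAt (by norm_num)
  have hd2 : fderiv ℝ (fderiv ℝ (fun y => u y + ε * v y)) x =
      fderiv ℝ (fderiv ℝ u) x + ε • fderiv ℝ (fderiv ℝ v) x := by
    rw [Filter.EventuallyEq.fderiv_eq hd]
    exact (hDu.hasFDerivAt.add (hDv.hasFDerivAt.const_smul ε)).fderiv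
  -- At a critical point of `u + ε v` the first order term of `u` is known from the barrier.
  have hzero : fderiv ℝ u x = -(ε • fderiv ℝ v x) := by
    have := hmax.fderiv_eq_zero
    rw [Filter.Eventually.self_of_nhds hd] at this
    exact eq_neg_of_add_eq_zero_left this
  have hnorm : ‖fderiv ℝ u x‖ = ε * (2 * a * v x * ‖x - c‖) := by
    rw [hzero, norm_neg, norm_smul, Real.norm_of_nonneg hε.le,
      (hasFDerivAt_gaussianBarrier a c x).fderiv, norm_smul, innerSL_apply_norm, ← hv,
      Real.norm_eq_abs, abs_mul, abs_mul, abs_of_pos hvx, abs_of_pos ha]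
    norm_num
  have hsum : ∑ i, fderiv ℝ (fderiv ℝ u) x (e i) (e i) ≤
      -(ε * ∑ i, fderiv ℝ (fderiv ℝ v) x (e i) (e i)) := by
    rw [Finset.mul_sum, ← Finset.sum_neg_distrib]
    refine Finset.sum_le_sum fun i _ => ?_
    have := fderiv_fderiv_nonpos_of_isLocalMax hwC hmax (e i)
    rw [hd2] at this
    simp at this
    linarith
  -- Ellipticity in the radial direction `x - c` yields the term of order `a²`, which dominates for
  -- large `a`.
  have hv2 : v x * (4 * a ^ 2 * (l * ‖x - c‖ ^ 2) - 2 * a * (Fintype.card ι * L ^ 2)) ≤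
      ∑ i, fderiv ℝ (fderiv ℝ v) x (e i) (e i) := by
    simp only [hv, fderiv_fderiv_gaussianBarrier]
    rw [← Finset.mul_sum]
    refine mul_le_mul_of_nonneg_left ?_ hvx.le
    rw [Finset.sum_sub_distrib, ← Finset.mul_sum, ← Finset.mul_sum]
    have h1 := hell (x - c)
    have h2 : ∑ i, ‖e i‖ ^ 2 ≤ Fintype.card ι * L ^ 2 := by
      calc ∑ i, ‖e i‖ ^ 2 ≤ ∑ _i : ι, L ^ 2 :=
            Finset.sum_le_sum fun i _ => pow_le_pow_left₀ (norm_nonneg _) (he i) 2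
        _ = _ := by simp
    have h3 := mul_le_mul_of_nonneg_left h1 (by positivity : 0 ≤ 4 * a ^ 2)
    have h4 := mul_le_mul_of_nonneg_left h2 (by positivity : 0 ≤ 2 * a)
    linarith
  -- Divided by `2 a ε v(x)`, this is the negation of `hal`.
  have key : ε * (v x * (4 * a ^ 2 * (l * ‖x - c‖ ^ 2) - 2 * a * (Fintype.card ι * L ^ 2))) ≤
      C * (ε * (2 * a * v x * ‖x - c‖)) := by
    rw [← hnorm]
    have := mul_le_mul_of_nonneg_left hv2 hε.le
    linarith
  have hpos : 0 < ε * (v x * (2 * a)) := by positivity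
  nlinarith [mul_lt_mul_of_pos_left hal hpos]

/-- **Strong maximum principle**, local form. -/
theorem eq_of_isMax_of_elliptic [FiniteDimensional ℝ E] {ι : Type*} [Fintype ι] {u : E → ℝ}
    {y₀ : E} {R l L C : ℝ}
    (hR : 0 < R) (hl : 0 < l) (hC : 0 ≤ C)
    (hu : ContDiffOn ℝ 2 u (ball y₀ R))
    (hL : ∀ y ∈ ball y₀ R, ∃ e : ι → E, (∀ i, ‖e i‖ ≤ L) ∧
      (∀ ξ : E, l * ‖ξ‖ ^ 2 ≤ ∑ i, inner ℝ (e i) ξ ^ 2) ∧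
      -(C * ‖fderiv ℝ u y‖) ≤ ∑ i, fderiv ℝ (fderiv ℝ u) y (e i) (e i))
    (hmax : ∀ y ∈ ball y₀ R, u y ≤ u y₀) :
    ∀ y ∈ ball y₀ (R / 2), u y = u y₀ := by
  intro y₁ hy₁
  by_contra hne
  have hsub : ball y₀ (R / 2) ⊆ ball y₀ R := ball_subset_ball (by linarith)
  -- Half the radius keeps the closed ball about `y₁` through `y₀` inside the domain.
  have hy₁' : dist y₁ y₀ < R / 2 := hy₁
  -- the point of the maximum set closest to `y₁`
  have hK : closedBall y₁ (dist y₁ y₀) ⊆ ball y₀ R := fun z hz => by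
    have h1 : dist z y₁ ≤ dist y₁ y₀ := hz
    have := dist_triangle z y₁ y₀
    rw [mem_ball]; linarith
  have hcont : ContinuousOn u (closedBall y₁ (dist y₁ y₀)) := hu.continuousOn.mono hK
  let S := closedBall y₁ (dist y₁ y₀) ∩ u ⁻¹' {u y₀}
  have hScl : IsClosed S := hcont.preimage_isClosed_of_isClosed isClosed_closedBall isClosed_singleton
  have hScomp : IsCompact S := (isCompact_closedBall _ _).of_isClosed_subset hScl inter_subset_left
  have hSne : S.Nonempty := ⟨y₀, by simp [dist_comm], rfl⟩
  obtain ⟨z, hzS, hz⟩ := hScomp.exists_isMinOn hSne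
    (continuous_id.dist continuous_const : Continuous fun y : E => dist y y₁).continuousOn
  have hzu : u z = u y₀ := hzS.2
  have hzR : z ∈ ball y₀ R := hK hzS.1
  set d := dist z y₁ with hd
  have hdle : d ≤ dist y₁ y₀ := hzS.1
  have hinside : ∀ x, dist x y₁ < d → u x < u y₀ := fun x hx => by
    have hxK : x ∈ closedBall y₁ (dist y₁ y₀) := (hx.trans_le hdle).le
    refine lt_of_le_of_ne (hmax x (hK hxK)) fun h => ?_
    have : d ≤ dist x y₁ := hz ⟨hxK, h⟩
    linarith
  have hdpos : 0 < d := by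
    refine dist_pos.2 fun h => hne ?_
    rw [← h]; exact hzu
  -- an inner ball touching the maximum set only at `z`
  set c := midpoint ℝ y₁ z with hc
  set r := d / 2 with hr
  have hrpos : 0 < r := by positivity
  have hzc : z - c = (2⁻¹ : ℝ) • (z - y₁) := by
    simp [hc, midpoint_eq_smul_add]; module
  have hcy : c - y₁ = (2⁻¹ : ℝ) • (z - y₁) := by
    simp [hc, midpoint_eq_smul_add]; module
  have hzcn : ‖z - c‖ = r := by
    rw [hzc, norm_smul, ← dist_eq_norm, ← hd]; norm_num; linarith
  have hcyn : ‖c - y₁‖ = r := by rw [hcy, ← hzc, hzcn]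
  -- By the parallelogram law, `‖x - c‖ ≤ r` and `‖x - y₁‖ ≥ 2r` force `x - c = c - y₁`, that is `x
  -- = z`.
  have hball : ∀ x, ‖x - c‖ ≤ r → x ≠ z → u x < u y₀ := fun x hx hxz => by
    refine hinside x ?_
    by_contra! hge
    have hxy : x - y₁ = (x - c) + (c - y₁) := by abel
    rw [dist_eq_norm, hxy] at hge
    have h1 := norm_add_sq_real (x - c) (c - y₁)
    have h2 := norm_sub_sq_real (x - c) (c - y₁)
    have h3 : d ^ 2 ≤ ‖(x - c) + (c - y₁)‖ ^ 2 := pow_le_pow_left₀ hdpos.le hge 2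
    have h4 : ‖x - c‖ ^ 2 ≤ r ^ 2 := pow_le_pow_left₀ (norm_nonneg _) hx 2
    rw [hcyn] at h1 h2
    have h5 : ‖(x - c) - (c - y₁)‖ ^ 2 ≤ 0 := by
      have : d = 2 * r := by rw [hr]; ring
      rw [this] at h3
      nlinarith
    have h6 : (x - c) - (c - y₁) = 0 := by
      rw [← norm_eq_zero]; exact pow_eq_zero_iff (two_ne_zero) |>.1 (le_antisymm h5 (by positivity))
    apply hxz
    have h7 : x - c = z - c := by rw [sub_eq_zero.1 h6, hcy, hzc]
    exact sub_left_injective h7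
  obtain ⟨δ₀, hδ₀, hδ₀sub⟩ := Metric.isOpen_iff.1 isOpen_ball z hzR
  set δ := min (δ₀ / 2) (r / 2) with hδ
  have hδpos : 0 < δ := by positivity
  have hδsub : closedBall z δ ⊆ ball y₀ R :=
    (closedBall_subset_ball (by have := min_le_left (δ₀ / 2) (r / 2); linarith)).trans hδ₀sub
  -- Keeps the small ball away from `c`, where the gradient of the barrier vanishes.
  have hδr : δ ≤ r / 2 := min_le_right _ _
  have hnear : ∀ x ∈ closedBall z δ, r / 2 ≤ ‖x - c‖ ∧ ‖x - c‖ ≤ 2 * r := fun x hx => by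
    have h1 : ‖x - z‖ ≤ δ := by simpa [dist_eq_norm] using hx
    have h2 := norm_sub_norm_le (z - c) (z - x)
    have h3 := norm_add_le (x - z) (z - c)
    rw [norm_sub_rev z x] at h2
    simp only [sub_sub_sub_cancel_left, sub_add_sub_cancel] at h2 h3
    constructor <;> linarith
  -- a steep barrier
  set m : ℝ := Fintype.card ι * L ^ 2 + C * (2 * r) + 1 with hm
  have hmpos : 0 < m := by positivity
  -- On the small ball `r / 2 ≤ ‖x - c‖ ≤ 2r`, so this `a` satisfies the steepness condition with a
  -- margin of at least `1`.
  set a : ℝ := m / (2 * l * (r / 2) ^ 2) with ha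
  have hapos : 0 < a := by positivity
  have ham : 2 * a * l * (r / 2) ^ 2 = m := by rw [ha]; field_simp
  -- `u` is bounded away from its maximum on part of the small sphere
  have hcomp : IsCompact (sphere z δ ∩ closedBall c r) :=
    (isCompact_sphere z δ).inter_right isClosed_closedBall
  have hcontδ : ContinuousOn u (closedBall z δ) := hu.continuousOn.mono hδsub
  obtain ⟨ε, hεpos, hε⟩ : ∃ ε > 0, ∀ x ∈ sphere z δ ∩ closedBall c r, u x + ε < u y₀ := by
    rcases (sphere z δ ∩ closedBall c r).eq_empty_or_nonempty with hemp | hnon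
    · exact ⟨1, one_pos, by simp [hemp]⟩
    · obtain ⟨x₁, hx₁, hx₁max⟩ := hcomp.exists_isMaxOn hnon
        (hcontδ.mono (inter_subset_left.trans sphere_subset_closedBall))
      have h1 : u x₁ < u y₀ := hball x₁ (by simpa [dist_eq_norm] using hx₁.2) fun h => by
        have := hx₁.1
        rw [h] at this
        simp at this
        exact hδpos.ne this
      refine ⟨(u y₀ - u x₁) / 2, by linarith, fun x hx => ?_⟩
      have : u x ≤ u x₁ := hx₁max hx
      linarith
  let w : E → ℝ := fun y => u y + ε * gaussianBarrier a c y
  have hwcont : ContinuousOn w (closedBall z δ) :=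
    hcontδ.add (continuousOn_const.mul (contDiff_gaussianBarrier a c).continuous.continuousOn)
  obtain ⟨x, hx, hxmax⟩ := (isCompact_closedBall z δ).exists_isMaxOn
    ⟨z, mem_closedBall_self hδpos.le⟩ hwcont
  have hxz : w z ≤ w x := hxmax (mem_closedBall_self hδpos.le)
  have hgz : gaussianBarrier a c z = Real.exp (-a * r ^ 2) := by rw [gaussianBarrier, hzcn]
  -- On the sphere `w < w z`: inside the ball about `c` because of the gap `ε` and barrier values at
  -- most `1`, outside because the barrier is smaller than at `z`.
  have hxball : x ∈ ball z δ := by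
    rw [mem_ball]
    refine lt_of_le_of_ne hx fun hsph => absurd hxz (not_le.2 ?_)
    show u x + ε * gaussianBarrier a c x < u z + ε * gaussianBarrier a c z
    rw [hzu]
    by_cases hxc : ‖x - c‖ ≤ r
    · have h1 := hε x ⟨hsph, by simpa [dist_eq_norm] using hxc⟩
      have h2 : gaussianBarrier a c x ≤ 1 := by
        rw [gaussianBarrier, Real.exp_le_one_iff]
        have : 0 ≤ a * ‖x - c‖ ^ 2 := by positivity
        linarith
      have h3 : 0 < gaussianBarrier a c z := Real.exp_pos _
      nlinarith
    · push Not at hxc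
      have h1 : gaussianBarrier a c x < gaussianBarrier a c z := by
        rw [hgz, gaussianBarrier, Real.exp_lt_exp]
        have : r ^ 2 < ‖x - c‖ ^ 2 := pow_lt_pow_left₀ hxc hrpos.le two_ne_zero
        nlinarith
      have h2 := hmax x (hδsub hx)
      nlinarith
  have hlocmax : IsLocalMax w x :=
    hxmax.isLocalMax (mem_of_superset (isOpen_ball.mem_nhds hxball) ball_subset_closedBall)
  obtain ⟨e, he, hell, hLu⟩ := hL x (hδsub hx)
  obtain ⟨hxc1, hxc2⟩ := hnear x hx
  refine not_isLocalMax_add_gaussianBarrier hεpos hapos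
    (hu.contDiffAt (isOpen_ball.mem_nhds (hδsub hx))) e he hell hLu ?_ hlocmax
  · have h1 : (r / 2) ^ 2 ≤ ‖x - c‖ ^ 2 := pow_le_pow_left₀ (by positivity) hxc1 2
    have h2 := mul_le_mul_of_nonneg_left h1 (by positivity : 0 ≤ 2 * a * l)
    have h3 := mul_le_mul_of_nonneg_left hxc2 hC
    rw [ham] at h2
    linarith

end MaximumPrinciple

/-! ### Linear algebra of calibrated planes -/

section FirstCousin

variable {V : Type*} [AddCommGroup V] [Module ℝ V] {p : ℕ} {B : LinearMap.BilinForm ℝ V}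

/-- The family `v` is orthonormal for the bilinear form `B`. -/
def OrthonormalFor (B : LinearMap.BilinForm ℝ V) (v : Fin p → V) : Prop :=
  ∀ i j, B (v i) (v j) = if i = j then 1 else 0

theorem OrthonormalFor.update (hs : ∀ v w, B v w = B w v) {ε : Fin p → V}
    (hε : OrthonormalFor B ε) (i : Fin p) {v : V} (hv : B v v = 1)
    (hvε : ∀ j ≠ i, B v (ε j) = 0) : OrthonormalFor B (Function.update ε i v) := by
  intro j k
  by_cases hj : j = i
  · subst hj
    by_cases hk : k = j
    · subst hk; simpa using hv
    · simpa [Function.update_of_ne hk, Ne.symm hk] using hvε k hk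
  · by_cases hk : k = i
    · subst hk
      simpa [Function.update_of_ne hj, hj, hs (ε j) v] using hvε j hj
    · simpa [Function.update_of_ne hj, Function.update_of_ne hk] using hε j k

/-- **First cousin principle**: a form of comass one vanishes on the first cousins of a plane on
which it attains its maximum (up to orientation). -/
theorem map_update_eq_zero_of_orthogonal (hs : ∀ v w, B v w = B w v)
    (hpos : ∀ v, v ≠ 0 → 0 < B v v) {φ : V [⋀^Fin p]→ₗ[ℝ] ℝ}
    (hφ : ∀ v : Fin p → V, OrthonormalFor B v → φ v ≤ 1) {ε : Fin p → V}
    (hε : OrthonormalFor B ε) (hφε : φ ε ^ 2 = 1) (i : Fin p) {N : V}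
    (hN : ∀ j, B N (ε j) = 0) : φ (Function.update ε i N) = 0 := by
  by_cases hN0 : N = 0
  · rw [hN0, AlternatingMap.map_update_zero]
  set t : ℝ := √(B N N) with ht
  have hBN := hpos N hN0
  have htpos : 0 < t := Real.sqrt_pos.2 hBN
  have htsq : t ^ 2 = B N N := Real.sq_sqrt hBN.le
  set N' : V := t⁻¹ • N with hN'
  have hN'N' : B N' N' = 1 := by
    simp only [hN', map_smul, LinearMap.smul_apply, smul_eq_mul]
    rw [← htsq]; field_simp
  have hN'ε : ∀ j, B N' (ε j) = 0 := fun j => by simp [hN', hN j]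
  set b : ℝ := φ (Function.update ε i N') with hb
  suffices hb0 : b = 0 by
    rw [hb, hN', AlternatingMap.map_update_smul, smul_eq_mul] at hb0
    exact (mul_eq_zero.1 hb0).resolve_left (inv_ne_zero htpos.ne')
  -- Rotating `ε i` towards `N'` to the unit vector `(c/s) ε i + (b/s) N'` gives `φ` the value `(c²
  -- + b²)/s = s`. Comass one then forces `b = 0`.
  set s : ℝ := √(1 + b ^ 2) with hsdef
  have hspos : 0 < s := Real.sqrt_pos.2 (by positivity)
  have hssq : s ^ 2 = 1 + b ^ 2 := Real.sq_sqrt (by positivity)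
  set c : ℝ := φ ε with hc
  have horth : OrthonormalFor B (Function.update ε i ((c / s) • ε i + (b / s) • N')) := by
    refine hε.update hs i ?_ fun j hj => ?_
    · have h1 : B (ε i) (ε i) = 1 := by simpa using hε i i
      simp only [map_add, map_smul, LinearMap.add_apply, LinearMap.smul_apply, smul_eq_mul,
        hN'N', hN'ε, h1, hs (ε i) N']
      have : c ^ 2 + b ^ 2 = s ^ 2 := by rw [hssq, hφε]
      field_simp
      linarith
    · have h1 : B (ε i) (ε j) = 0 := by simpa [Ne.symm hj] using hε i j
      simp [hN'ε, h1]
  have hle := hφ _ horth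
  rw [AlternatingMap.map_update_add, AlternatingMap.map_update_smul,
    AlternatingMap.map_update_smul, Function.update_eq_self, ← hb, ← hc, smul_eq_mul,
    smul_eq_mul] at hle
  have h1 : c / s * c + b / s * b = s := by
    field_simp
    rw [hssq, hφε]
  rw [h1] at hle
  have : s ^ 2 ≤ 1 := by nlinarith
  have : b ^ 2 ≤ 0 := by linarith
  exact pow_eq_zero_iff two_ne_zero |>.1 (le_antisymm this (sq_nonneg b))

/-- At an orthonormal basis of a calibrated plane the form is the orthogonal projection in each
argument. -/
theorem map_update_eq_inner (hs : ∀ v w, B v w = B w v)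
    (hpos : ∀ v, v ≠ 0 → 0 < B v v) {φ : V [⋀^Fin p]→ₗ[ℝ] ℝ}
    (hφ : ∀ v : Fin p → V, OrthonormalFor B v → φ v ≤ 1) {ε : Fin p → V}
    (hε : OrthonormalFor B ε) (hφε : φ ε = 1) (i : Fin p) (v : V) :
    φ (Function.update ε i v) = B v (ε i) := by
  -- The normal part contributes nothing by the first cousin principle, and the components with `j ≠
  -- i` repeat an argument.
  have hv : v = ∑ j, B v (ε j) • ε j + (v - ∑ j, B v (ε j) • ε j) := by abel
  have hN : ∀ k, B (v - ∑ j, B v (ε j) • ε j) (ε k) = 0 := fun k => by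
    simp [map_sub, map_sum, LinearMap.sum_apply, hε _ k]
  conv_lhs => rw [hv]
  rw [AlternatingMap.map_update_add, map_update_eq_zero_of_orthogonal hs hpos hφ hε
    (by rw [hφε, one_pow]) i hN, add_zero, AlternatingMap.map_update_sum,
    Finset.sum_eq_single i]
  · rw [AlternatingMap.map_update_smul, Function.update_eq_self, hφε, smul_eq_mul, mul_one]
  · intro j _ hj
    rw [AlternatingMap.map_update_smul, AlternatingMap.map_update_self _ _ hj.symm, smul_zero]
  · simp

theorem OrthonormalFor.linearIndependent {ε : Fin p → V} (hε : OrthonormalFor B ε) :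
    LinearIndependent ℝ ε := by
  rw [Fintype.linearIndependent_iff]
  intro c hc i
  have : B (∑ j, c j • ε j) (ε i) = 0 := by rw [hc]; simp
  simpa [map_sum, LinearMap.sum_apply, hε _ i] using this

theorem OrthonormalFor.sum_smul_eq {ε : Fin p → V} [NeZero p] (hε : OrthonormalFor B ε)
    (hp : p = Module.finrank ℝ V) (v : V) : ∑ i, B v (ε i) • ε i = v := by
  let b := basisOfLinearIndependentOfCardEqFinrank hε.linearIndependent (by simpa using hp)
  have hb : ∀ i, b i = ε i := fun i => by simp [b]
  have hrep : v = ∑ i, b.repr v i • ε i := by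
    conv_lhs => rw [← b.sum_repr v]
    simp [hb]
  have hc : ∀ i, B v (ε i) = b.repr v i := fun i => by
    conv_lhs => rw [hrep]
    simp [map_sum, LinearMap.sum_apply, hε _ i]
  simp only [hc]
  exact hrep.symm

/-- Let `D` map an orthonormal basis `e` for the pulled back inner product to a calibrated plane.
In the first argument of the pulled back calibration only the tangential component matters. -/
theorem map_cons_eq_of_tangential {q : ℕ} {E : Type*} [AddCommGroup E] [Module ℝ E]
    (hs : ∀ v w, B v w = B w v)
    (hpos : ∀ v, v ≠ 0 → 0 < B v v) {φ : V [⋀^Fin (q + 1)]→ₗ[ℝ] ℝ}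
    (hφ : ∀ v : Fin (q + 1) → V, OrthonormalFor B v → φ v ≤ 1) (D : E →ₗ[ℝ] V)
    (hE : q + 1 = Module.finrank ℝ E) {e : Fin (q + 1) → E}
    (hε : OrthonormalFor B (D ∘ e)) (hφε : φ (D ∘ e) = 1) {v : V} {w : E}
    (hvw : ∀ x, B v (D x) = B (D w) (D x)) (t : Fin q → E) :
    φ (Fin.cons v (D ∘ t)) = φ (Fin.cons (D w) (D ∘ t)) := by
  have hli : LinearIndependent ℝ e := LinearIndependent.of_comp D hε.linearIndependent
  let b := basisOfLinearIndependentOfCardEqFinrank hli (by simpa using hE)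
  have hb : ∀ i, b i = e i := fun i => by simp [b]
  have hzero : (φ.curryLeft (v - D w)).compLinearMap D = 0 := by
    refine Module.Basis.ext_alternating b fun σ hσ => ?_
    -- Putting the one missing index in front turns `σ` into a permutation of the frame, whose first
    -- vector is then replaced by the normal vector `v - D w`.
    obtain ⟨i, hi⟩ : ∃ i, i ∉ Set.range σ := by
      by_contra! h
      have := Fintype.card_le_of_surjective σ h
      simp at this
    have hinj : Function.Injective (Fin.cons i σ : Fin (q + 1) → Fin (q + 1)) :=
      Fin.cons_injective_iff.2 ⟨hi, hσ⟩
    let τ : Equiv.Perm (Fin (q + 1)) :=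
      Equiv.ofBijective _ (Finite.injective_iff_bijective.1 hinj)
    have hτ : OrthonormalFor B ((D ∘ e) ∘ τ) := fun j k => by
      have := hε (τ j) (τ k)
      simpa [τ.injective.eq_iff] using this
    -- The permutation may be odd, which is why the first cousin principle only asks for `φ = ±1` on
    -- the frame.
    have hφτ : φ ((D ∘ e) ∘ τ) ^ 2 = 1 := by
      rw [AlternatingMap.map_perm, hφε]
      rcases Int.units_eq_one_or (Equiv.Perm.sign τ) with h | h <;> simp [h]
    have hN : ∀ j, B (v - D w) (((D ∘ e) ∘ τ) j) = 0 := fun j => by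
      simp [map_sub, hvw]
    have h0 := map_update_eq_zero_of_orthogonal hs hpos hφ hτ hφτ 0 hN
    have hup : Function.update ((D ∘ e) ∘ τ) 0 (v - D w) =
        Fin.cons (v - D w) (fun j => D (b (σ j))) := by
      ext j
      refine Fin.cases ?_ (fun j => ?_) j
      · simp
      · simp [τ, hb]
    rw [hup] at h0
    exact h0
  have h := congrArg (fun f => f t) hzero
  have h' : φ (Fin.cons (v - D w) (D ∘ t)) = 0 := h
  have hup : ∀ z : V, (Fin.cons z (D ∘ t) : Fin (q + 1) → V) =
      Function.update (Fin.cons 0 (D ∘ t)) 0 z := fun z => by simp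
  rw [hup, AlternatingMap.map_update_sub, ← hup, ← hup] at h'
  exact sub_eq_zero.1 h'

end FirstCousin

/-! ### The second order identity on a calibrated frame -/

section Core

variable {E : Type*} [NormedAddCommGroup E] [NormedSpace ℝ E] {q : ℕ}

theorem map_vecCons_removeNth (f : E [⋀^Fin (q + 1)]→L[ℝ] ℝ) (e : Fin (q + 1) → E)
    (i : Fin (q + 1)) (v : E) :
    (-1 : ℝ) ^ (i : ℕ) * f (Matrix.vecCons v (i.removeNth e)) = f (Function.update e i v) := by
  have := f.toAlternatingMap.neg_one_pow_smul_map_insertNth i v (i.removeNth e)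
  rw [Fin.insertNth_removeNth] at this
  have h2 : f (Function.update e i v) * (-1 : ℝ) ^ (i : ℕ) =
      f (Matrix.vecCons v (i.removeNth e)) := by
    rw [mul_comm]
    simpa [zsmul_eq_mul] using! this
  rw [← h2, mul_comm, mul_assoc, ← mul_pow]
  simp

/-- If `e` is a calibrated frame, then the exterior derivative of `w ⌟ Φ`, with `w` the gradient of
`u`, has the principal part `∑ D²u(eᵢ, eᵢ)` on `e`. -/
theorem sum_fderiv_fderiv_eq {u : E → ℝ} {H : E → E →L[ℝ] E →L[ℝ] ℝ}
    {Φ : E → E [⋀^Fin (q + 1)]→L[ℝ] ℝ} {w : E → E} {y : E}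
    (hH : DifferentiableAt ℝ H y) (hΦ : DifferentiableAt ℝ Φ y) (hw : DifferentiableAt ℝ w y)
    (hHw : ∀ᶠ z in 𝓝 y, H z (w z) = fderiv ℝ u z) {e : Fin (q + 1) → E}
    (hcal : ∀ i v, Φ y (Function.update e i v) = H y v (e i)) :
    ∑ i, fderiv ℝ (fderiv ℝ u) y (e i) (e i) =
      extDeriv (fun z => (Φ z).curryLeft (w z)) y e +
      ∑ i, (fderiv ℝ H y (e i) (w y) (e i) - (-1 : ℝ) ^ (i : ℕ) *
        (fderiv ℝ Φ y (e i)).curryLeft (w y) (i.removeNth e)) := by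
  have hd2 : fderiv ℝ (fderiv ℝ u) y = (H y).comp (fderiv ℝ w y) + (fderiv ℝ H y).flip (w y) := by
    rw [← Filter.EventuallyEq.fderiv_eq hHw]
    exact (hH.hasFDerivAt.clm_apply hw.hasFDerivAt).fderiv
  let c := (ContinuousAlternatingMap.curryLeftLI (𝕜 := ℝ) (E := E) (F := ℝ)
      (n := q)).toContinuousLinearMap
  have hc : ∀ f, c f = f.curryLeft := fun f => rfl
  have hcΦ : HasFDerivAt (fun z => (Φ z).curryLeft) (c.comp (fderiv ℝ Φ y)) y := by
    have h1 := c.hasFDerivAt (x := Φ y)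
    exact HasFDerivAt.comp (G := E →L[ℝ] E [⋀^Fin q]→L[ℝ] ℝ) y h1 hΦ.hasFDerivAt
  have hθ : fderiv ℝ (fun z => (Φ z).curryLeft (w z)) y =
      (c (Φ y)).comp (fderiv ℝ w y) + (c.comp (fderiv ℝ Φ y)).flip (w y) :=
    (hcΦ.clm_apply hw.hasFDerivAt).fderiv
  rw [extDeriv, ContinuousAlternatingMap.alternatizeUncurryFin_apply, ← Finset.sum_add_distrib]
  refine Finset.sum_congr rfl fun i _ => ?_
  rw [hθ, hd2]
  simp only [add_apply, ContinuousLinearMap.comp_apply,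
    ContinuousLinearMap.flip_apply, hc, ContinuousAlternatingMap.add_apply,
    ContinuousAlternatingMap.curryLeft_apply_apply, smul_add, zsmul_eq_mul]
  push_cast
  -- The sign moves `Dw(eᵢ)` into the `i`-th slot, where the calibration returns `H(Dw(eᵢ), eᵢ)`,
  -- the same principal term as in `D²u(eᵢ, eᵢ)`.
  rw [map_vecCons_removeNth, hcal]
  ring

end Core

/-! ### Pull-backs of forms and of the metric to a vector space -/

section PullBack

variable {n : ℕ} {X : Type*} [TopologicalSpace X] [ChartedSpace (Euc n) X]
  {E : Type*} [NormedAddCommGroup E] [NormedSpace ℝ E]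

/-- The pull-back of a form on `X` under a map from a normed space. -/
def pullForm {p : ℕ} (P : E → X) (η : Form n X p) (y : E) : E [⋀^Fin p]→L[ℝ] ℝ :=
  (η (P y)).compContinuousLinearMap (mfderiv 𝓘(ℝ, E) (𝓡 n) P y)

theorem mfderiv_eq_comp_fderiv [IsManifold (𝓡 n) ∞ X] {P : E → X} {y : E} (x₀ : X)
    (hP : MDifferentiableAt 𝓘(ℝ, E) (𝓡 n) P y) (hx₀ : P y ∈ (chartAt (Euc n) x₀).source) (v : E) :
    (mfderiv 𝓘(ℝ, E) (𝓡 n) P y v : Euc n) =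
      mfderiv 𝓘(ℝ, Euc n) (𝓡 n) (extChartAt (𝓡 n) x₀).symm (extChartAt (𝓡 n) x₀ (P y))
        (fderiv ℝ (fun z => extChartAt (𝓡 n) x₀ (P z)) y v) := by
  have : IsManifold (𝓡 n) 1 X := IsManifold.of_le (n := ∞) (by simp)
  have hsrc : P y ∈ (extChartAt (𝓡 n) x₀).source := by rwa [extChartAt_source]
  have hF : MDifferentiableAt 𝓘(ℝ, E) 𝓘(ℝ, Euc n) (fun z => extChartAt (𝓡 n) x₀ (P z)) y :=
    (mdifferentiableAt_extChartAt hx₀).comp y hP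
  have hS : MDifferentiableAt 𝓘(ℝ, Euc n) (𝓡 n) (extChartAt (𝓡 n) x₀).symm
      (extChartAt (𝓡 n) x₀ (P y)) := by
    have := mdifferentiableWithinAt_extChartAt_symm ((extChartAt (𝓡 n) x₀).map_source hsrc)
    simpa [mdifferentiableWithinAt_univ] using this
  have heq : P =ᶠ[𝓝 y] (extChartAt (𝓡 n) x₀).symm ∘ (fun z => extChartAt (𝓡 n) x₀ (P z)) := by
    filter_upwards [hP.continuousAt.eventually ((isOpen_extChartAt_source x₀).mem_nhds hsrc)]
      with z hz
    exact ((extChartAt (𝓡 n) x₀).left_inv hz).symm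
  have h1 : HasMFDerivAt 𝓘(ℝ, E) (𝓡 n)
      ((extChartAt (𝓡 n) x₀).symm ∘ (fun z => extChartAt (𝓡 n) x₀ (P z))) y _ :=
    hS.hasMFDerivAt.comp y hF.hasMFDerivAt
  have h2 := (h1.congr_of_eventuallyEq heq).mfderiv
  have h3 := congrArg (fun (L : E →L[ℝ] Euc n) => L v) h2
  rw [mfderiv_eq_fderiv] at h3
  exact h3

variable [IsManifold (𝓡 n) ∞ X]

/-- Freezes one chart for all points near `y`, so that calculus between vector spaces applies to the
pull-back. -/
theorem pullForm_eventuallyEq {p : ℕ} (η : Form n X p) {P : E → X} {y : E} (x₀ : X)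
    (hP : ∀ᶠ z in 𝓝 y, MDifferentiableAt 𝓘(ℝ, E) (𝓡 n) P z)
    (hx₀ : P y ∈ (chartAt (Euc n) x₀).source) :
    pullForm P η =ᶠ[𝓝 y] fun z =>
      (formInChart η x₀ (extChartAt (𝓡 n) x₀ (P z))).compContinuousLinearMap
        (fderiv ℝ (fun z => extChartAt (𝓡 n) x₀ (P z)) z) := by
  have hsrc : P y ∈ (extChartAt (𝓡 n) x₀).source := by rwa [extChartAt_source]
  filter_upwards [hP, hP.self_of_nhds.continuousAt.eventually
    ((isOpen_extChartAt_source x₀).mem_nhds hsrc)] with z hz hzs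
  ext v
  have h1 := mfderiv_eq_comp_fderiv x₀ hz (by rwa [extChartAt_source] at hzs)
  have h2 : (extChartAt (𝓡 n) x₀).symm (extChartAt (𝓡 n) x₀ (P z)) = P z :=
    (extChartAt (𝓡 n) x₀).left_inv hzs
  let ηf : X → (Euc n) [⋀^Fin p]→L[ℝ] ℝ := fun x => η x
  exact (congrArg (ηf (P z)) (funext fun i => h1 (v i))).trans
    (DFunLike.congr_fun (congrArg ηf h2).symm _)

theorem contDiffAt_extChartAt_comp {P : E → X} {y : E} (x₀ : X)
    (hP : ContMDiffAt 𝓘(ℝ, E) (𝓡 n) ∞ P y) (hx₀ : P y ∈ (chartAt (Euc n) x₀).source) :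
    ContDiffAt ℝ ∞ (fun z => extChartAt (𝓡 n) x₀ (P z)) y :=
  ((contMDiffAt_extChartAt' hx₀).comp y hP).contDiffAt

theorem eventually_mdifferentiableAt {P : E → X} {y : E}
    (hP : ContMDiffAt 𝓘(ℝ, E) (𝓡 n) ∞ P y) :
    ∀ᶠ z in 𝓝 y, MDifferentiableAt 𝓘(ℝ, E) (𝓡 n) P z := by
  have : IsManifold (𝓡 n) 1 X := IsManifold.of_le (n := ∞) (by simp)
  have h1 : ContMDiffAt 𝓘(ℝ, E) (𝓡 n) 1 P y := hP.of_le (by simp)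
  filter_upwards [(contMDiffAt_iff_contMDiffAt_nhds (by simp)).1 h1] with z hz
  exact hz.mdifferentiableAt (by simp)

omit [IsManifold (𝓡 n) ∞ X] in
theorem contDiffAt_formInChart {p : ℕ} {η : Form n X p} (hη : IsSmoothForm η) (x : X) :
    ContDiffAt ℝ ∞ (formInChart η x) (extChartAt (𝓡 n) x x) :=
  (hη x).contDiffAt (extChartAt_target_mem_nhds x)

theorem exists_hasStrictFDerivAt_pullForm {p : ℕ} {η : Form n X p} (hη : IsSmoothForm η)
    {P : E → X} {y : E} (hP : ContMDiffAt 𝓘(ℝ, E) (𝓡 n) ∞ P y) :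
    ∃ L : E →L[ℝ] E [⋀^Fin p]→L[ℝ] ℝ, HasStrictFDerivAt (pullForm P η) L y := by
  have hF := contDiffAt_extChartAt_comp (P y) hP (mem_chart_source _ _)
  have hη' := contDiffAt_formInChart hη (P y)
  have h1 : ContDiffAt ℝ ∞ (fun z => formInChart η (P y) (extChartAt (𝓡 n) (P y) (P z))) y :=
    ContDiffAt.comp (f := fun z => extChartAt (𝓡 n) (P y) (P z)) y hη' hF
  have h2 : ContDiffAt ℝ ∞ (fderiv ℝ (fun z => extChartAt (𝓡 n) (P y) (P z))) y :=
    hF.fderiv_right (by simp)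
  have h3 := (h1.hasStrictFDerivAt (by simp)).continuousAlternatingMapCompContinuousLinearMap
    (h2.hasStrictFDerivAt (by simp))
  exact ⟨_, h3.congr_of_eventuallyEq (pullForm_eventuallyEq η (P y)
    (eventually_mdifferentiableAt hP) (mem_chart_source _ _)).symm⟩

/-- The exterior derivative commutes with pull-backs. -/
theorem extDeriv_pullForm {p : ℕ} {η : Form n X p} (hη : IsSmoothForm η)
    {P : E → X} {y : E} (hP : ContMDiffAt 𝓘(ℝ, E) (𝓡 n) ∞ P y) :
    extDeriv (pullForm P η) y = pullForm P (extD η) y := by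
  have : IsManifold (𝓡 n) 1 X := IsManifold.of_le (n := ∞) (by simp)
  -- The chart around `P y` is the one that defines `extD η` at `P y`, so independence of the chart
  -- is not needed.
  have hF := contDiffAt_extChartAt_comp (P y) hP (mem_chart_source _ _)
  have hη' := contDiffAt_formInChart hη (P y)
  rw [(pullForm_eventuallyEq η (P y) (eventually_mdifferentiableAt hP)
    (mem_chart_source _ _)).extDeriv_eq,
    extDeriv_pullback (f := fun z => extChartAt (𝓡 n) (P y) (P z))
      (hη'.differentiableAt (by simp)) hF
    (by simpa using WithTop.coe_le_coe.2 (le_top : (2 : ℕ∞) ≤ ⊤))]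
  ext v
  have h1 : ∀ w : E, fderiv ℝ (fun z => extChartAt (𝓡 n) (P y) (P z)) y w =
      mfderiv (𝓡 n) 𝓘(ℝ, Euc n) (extChartAt (𝓡 n) (P y)) (P y) (mfderiv 𝓘(ℝ, E) (𝓡 n) P y w) := by
    intro w
    rw [← mfderiv_eq_fderiv]
    have := (mdifferentiableAt_extChartAt (I := 𝓡 n)
      (mem_chart_source (Euc n) (P y))).hasMFDerivAt.comp y
      (hP.mdifferentiableAt (by simp)).hasMFDerivAt
    exact congrArg (fun (L : E →L[ℝ] Euc n) => L w) this.mfderiv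
  show extDeriv _ _ (fun i => fderiv ℝ (fun z => extChartAt (𝓡 n) (P y) (P z)) y (v i)) =
    extDeriv (formInChart η (P y)) (extChartAt (𝓡 n) (P y) (P y)) (fun i =>
      mfderiv (𝓡 n) 𝓘(ℝ, Euc n) (extChartAt (𝓡 n) (P y)) (P y)
        (mfderiv 𝓘(ℝ, E) (𝓡 n) P y (v i)))
  exact congrArg _ (funext fun i => h1 (v i))

/-- The pull-back of the metric of `X` under a map from a normed space. -/
def pullMetric (g : Metric n X) (P : E → X) (y : E) : E →L[ℝ] E →L[ℝ] ℝ :=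
  ContinuousLinearMap.bilinearComp (E := Euc n) (F := Euc n) (g.inner (P y))
    (mfderiv 𝓘(ℝ, E) (𝓡 n) P y) (mfderiv 𝓘(ℝ, E) (𝓡 n) P y)

theorem pullMetric_apply (g : Metric n X) (P : E → X) (y v w : E) :
    pullMetric g P y v w =
      g.inner (P y) (mfderiv 𝓘(ℝ, E) (𝓡 n) P y v) (mfderiv 𝓘(ℝ, E) (𝓡 n) P y w) := rfl

theorem contMDiffOn_mfderiv_const {P : E → X} {U : Set E} (hU : IsOpen U)
    (hP : ContMDiffOn 𝓘(ℝ, E) (𝓡 n) ∞ P U) (v : E) :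
    ContMDiffOn 𝓘(ℝ, E) (𝓡 n).tangent ∞
      (fun y => (⟨P y, mfderiv 𝓘(ℝ, E) (𝓡 n) P y v⟩ : TangentBundle (𝓡 n) X)) U := by
  have : IsManifold (𝓡 n) 1 X := IsManifold.of_le (n := ∞) (by simp)
  have h1 := hP.contMDiffOn_tangentMapWithin (m := ∞) (by simp) hU.uniqueMDiffOn
  have h2 : ContMDiffOn 𝓘(ℝ, E) 𝓘(ℝ, E).tangent ∞
      (fun y => (⟨y, v⟩ : TangentBundle 𝓘(ℝ, E) E)) U :=
    contMDiffOn_vectorSpace_iff_contDiffOn.2 contDiffOn_const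
  refine (h1.comp h2 fun y hy => hy).congr fun y hy => ?_
  simp [tangentMapWithin, mfderivWithin_of_isOpen hU hy]

theorem contDiffOn_pullMetric [FiniteDimensional ℝ E] (g : Metric n X) {P : E → X} {U : Set E}
    (hU : IsOpen U) (hP : ContMDiffOn 𝓘(ℝ, E) (𝓡 n) ∞ P U) :
    ContDiffOn ℝ ∞ (pullMetric g P) U := by
  rw [contDiffOn_clm_apply]
  intro v
  rw [contDiffOn_clm_apply]
  intro w
  rw [← contMDiffOn_iff_contDiffOn]
  have hg : ContMDiffOn 𝓘(ℝ, E) ((𝓡 n).prod 𝓘(ℝ, Euc n →L[ℝ] Euc n →L[ℝ] ℝ)) ∞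
      (fun y => Bundle.TotalSpace.mk' (Euc n →L[ℝ] Euc n →L[ℝ] ℝ)
        (E := fun x : X => TangentSpace (𝓡 n) x →L[ℝ] TangentSpace (𝓡 n) x →L[ℝ] ℝ)
        (P y) (g.inner (P y))) U :=
    g.contMDiff.comp_contMDiffOn hP
  have := ContMDiffOn.clm_bundle_apply₂ (F₁ := Euc n) (F₂ := Euc n) (F₃ := ℝ)
      (E₃ := Bundle.Trivial X ℝ) hg (contMDiffOn_mfderiv_const hU hP v)
      (contMDiffOn_mfderiv_const hU hP w)
  intro y hy
  have h := this y hy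
  simp only [Bundle.contMDiffWithinAt_totalSpace] at h
  exact h.2

end PullBack

/-! ### Inversion and coercivity of inner products, and smoothness of `d^φ f` -/

section InnerProducts

variable {E : Type*} [NormedAddCommGroup E] [NormedSpace ℝ E] [FiniteDimensional ℝ E]

theorem isInvertible_of_forall_pos {H : E →L[ℝ] E →L[ℝ] ℝ} (hH : ∀ v, v ≠ 0 → 0 < H v v) :
    H.IsInvertible := by
  have hinj : Function.Injective H := by
    rw [injective_iff_map_eq_zero]
    intro v hv
    by_contra hne
    exact (hH v hne).ne' (by rw [hv]; rfl)
  have hrank : Module.finrank ℝ E = Module.finrank ℝ (E →L[ℝ] ℝ) := by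
    rw [← (LinearMap.toContinuousLinearMap (𝕜 := ℝ) (E := E) (F' := ℝ)).finrank_eq]
    exact Subspace.dual_finrank_eq.symm
  exact ⟨(LinearEquiv.ofInjectiveOfFinrankEq (H : E →ₗ[ℝ] E →L[ℝ] ℝ) hinj
    hrank).toContinuousLinearEquiv, by ext; rfl⟩

omit [FiniteDimensional ℝ E] in
theorem apply_inverse_of_isInvertible {F : Type*} [NormedAddCommGroup F] [NormedSpace ℝ F]
    {H : E →L[ℝ] F} (hH : H.IsInvertible) (v : F) : H (H.inverse v) = v := by
  obtain ⟨M, rfl⟩ := hH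
  simp

/-- A continuous family of inner products is locally uniformly coercive. -/
theorem exists_eventually_coercive {Y : Type*} [TopologicalSpace Y] {H : Y → E →L[ℝ] E →L[ℝ] ℝ}
    {y₀ : Y} (hc : ContinuousAt H y₀) (hH : ∀ v, v ≠ 0 → 0 < H y₀ v v) :
    ∃ c > 0, ∀ᶠ y in 𝓝 y₀, ∀ v, c * ‖v‖ ^ 2 ≤ H y v v := by
  obtain ⟨c, hcpos, hcle⟩ : ∃ c > 0, ∀ v, c * ‖v‖ ^ 2 ≤ H y₀ v v := by
    rcases (Metric.sphere (0 : E) 1).eq_empty_or_nonempty with hemp | hne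
    · refine ⟨1, one_pos, fun v => ?_⟩
      by_cases hv : v = 0
      · simp [hv]
      · exfalso
        have : ‖v‖⁻¹ • v ∈ Metric.sphere (0 : E) 1 := by simp [norm_smul, hv]
        rw [hemp] at this
        exact this
    · obtain ⟨x, hx, hmin⟩ := (isCompact_sphere (0 : E) 1).exists_isMinOn hne
        (f := fun v => H y₀ v v) (by fun_prop)
      have hx0 : x ≠ 0 := by rintro rfl; simp at hx
      refine ⟨H y₀ x x, hH x hx0, fun v => ?_⟩
      by_cases hv : v = 0
      · simp [hv]
      · have hmem : ‖v‖⁻¹ • v ∈ Metric.sphere (0 : E) 1 := by simp [norm_smul, hv]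
        have h1 : H y₀ x x ≤ H y₀ (‖v‖⁻¹ • v) (‖v‖⁻¹ • v) := hmin hmem
        simp only [map_smul, smul_apply, smul_eq_mul] at h1
        have hvn : 0 < ‖v‖ := norm_pos_iff.2 hv
        calc H y₀ x x * ‖v‖ ^ 2 ≤ ‖v‖⁻¹ * (‖v‖⁻¹ * H y₀ v v) * ‖v‖ ^ 2 := by gcongr
          _ = H y₀ v v := by field_simp
  refine ⟨c / 2, by positivity, ?_⟩
  have hball : Metric.ball (H y₀) (c / 2) ∈ 𝓝 (H y₀) :=
    Metric.ball_mem_nhds (α := E →L[ℝ] E →L[ℝ] ℝ) (H y₀) (half_pos hcpos)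
  filter_upwards [hc.preimage_mem_nhds hball] with y hy v
  have h1 : ‖H y - H y₀‖ ≤ c / 2 :=
    (mem_ball_iff_norm (E := E →L[ℝ] E →L[ℝ] ℝ) (a := H y₀) (b := H y)).1 hy |>.le
  have h2 : |(H y - H y₀) v v| ≤ c / 2 * ‖v‖ * ‖v‖ := by
    refine ((H y - H y₀).le_opNorm₂ v v).trans ?_
    gcongr
  have h3 := (abs_le.1 h2).1
  have h4 := hcle v
  simp only [sub_apply] at h3
  nlinarith

end InnerProducts

variable {n : ℕ} {X : Type*} [TopologicalSpace X] [ChartedSpace (Euc n) X]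
  [IsManifold (𝓡 n) ∞ X]

/-- The metric at a point as a bilinear form. -/
def metricForm (g : Metric n X) (x : X) : LinearMap.BilinForm ℝ (TangentSpace (𝓡 n) x) where
  toFun v := (g.inner x v : TangentSpace (𝓡 n) x →ₗ[ℝ] ℝ)
  map_add' v w := by ext; simp
  map_smul' c v := by ext; simp

theorem metricForm_apply (g : Metric n X) (x : X) (v w : TangentSpace (𝓡 n) x) :
    metricForm g x v w = g.inner x v w := rfl

theorem eq_gradient_iff (g : Metric n X) (f : X → ℝ) (x : X) (v : TangentSpace (𝓡 n) x)
    (h : ∀ w, g.inner x v w = differential f x w) : v = gradient g f x := by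
  by_contra hne
  have hpos := g.pos x (v - gradient g f x) (sub_ne_zero.2 hne)
  have h0 : metricForm g x (v - gradient g f x) (v - gradient g f x) = 0 := by
    rw [map_sub (metricForm g x), LinearMap.sub_apply, metricForm_apply, metricForm_apply, h,
      inner_gradient, sub_self]
  exact hpos.ne' h0

section Pullback

variable {E : Type*} [NormedAddCommGroup E] [NormedSpace ℝ E]

omit [IsManifold (𝓡 n) ∞ X] in
theorem differential_mfderiv {f : X → ℝ} (hf : ContMDiff (𝓡 n) 𝓘(ℝ, ℝ) ∞ f) {P : E → X} {y : E}
    (hP : MDifferentiableAt 𝓘(ℝ, E) (𝓡 n) P y) (v : E) :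
    differential f (P y) (mfderiv 𝓘(ℝ, E) (𝓡 n) P y v) = fderiv ℝ (f ∘ P) y v := by
  have h := ((hf.mdifferentiableAt (by simp)).hasMFDerivAt.comp y hP.hasMFDerivAt).mfderiv
  rw [mfderiv_eq_fderiv] at h
  exact (congrArg (fun L : E →L[ℝ] ℝ => L v) h).symm

variable [FiniteDimensional ℝ E]

theorem contDiffAt_inverse_fderiv {H : E → E →L[ℝ] E →L[ℝ] ℝ} {u : E → ℝ} {y : E}
    (hH : ContDiffAt ℝ ∞ H y) (hu : ContDiffAt ℝ ∞ u y) (hpos : ∀ v, v ≠ 0 → 0 < H y v v) :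
    ContDiffAt ℝ ∞ (fun z => (H z).inverse (fderiv ℝ u z)) y := by
  have h1 : ContDiffAt ℝ ∞ (fun z => (H z).inverse) y :=
    ContDiffAt.comp (g := ContinuousLinearMap.inverse) y
      (isInvertible_of_forall_pos hpos).contDiffAt_map_inverse hH
  exact h1.clm_apply (hu.fderiv_right (by simp))

end Pullback

/-- Needed to pull `dd^φ f` back by `extDeriv_pullForm`. In a chart the gradient is the inverse of
the metric applied to the differential of `f`, and inversion of operators is smooth. -/
theorem IsSmoothForm.dPhi {q : ℕ} (g : Metric n X) {φ : Form n X (q + 1)} (hφ : IsSmoothForm φ)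
    {f : X → ℝ} (hf : ContMDiff (𝓡 n) 𝓘(ℝ, ℝ) ∞ f) : IsSmoothForm (dPhi g φ f) := by
  have : IsManifold (𝓡 n) 1 X := IsManifold.of_le (n := ∞) (by simp)
  intro x₀
  set χ := extChartAt (𝓡 n) x₀ with hχ
  have hopen : IsOpen χ.target := isOpen_extChartAt_target x₀
  have hP : ContMDiffOn 𝓘(ℝ, Euc n) (𝓡 n) ∞ χ.symm χ.target := contMDiffOn_extChartAt_symm x₀
  have hPd : ∀ z ∈ χ.target, MDifferentiableAt 𝓘(ℝ, Euc n) (𝓡 n) χ.symm z := fun z hz =>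
    (hP.contMDiffAt (hopen.mem_nhds hz)).mdifferentiableAt (by simp)
  have hinv : ∀ z ∈ χ.target, (mfderiv 𝓘(ℝ, Euc n) (𝓡 n) χ.symm z).IsInvertible := fun z hz => by
    have := isInvertible_mfderivWithin_extChartAt_symm (I := 𝓡 n) hz
    rw [ModelWithCorners.range_eq_univ, mfderivWithin_univ] at this
    exact this
  set G := pullMetric g χ.symm with hG
  have hGpos : ∀ z ∈ χ.target, ∀ v, v ≠ 0 → 0 < G z v v := fun z hz v hv => by
    rw [hG, pullMetric_apply]
    refine g.pos _ _ fun h => hv ?_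
    exact (hinv z hz).injective (h.trans (map_zero _).symm)
  set W : Euc n → Euc n := fun z => (G z).inverse (fderiv ℝ (f ∘ χ.symm) z) with hW
  have hWsm : ContDiffOn ℝ ∞ W χ.target := fun z hz =>
    (contDiffAt_inverse_fderiv ((contDiffOn_pullMetric g hopen hP).contDiffAt (hopen.mem_nhds hz))
      ((hf.contMDiffAt.comp z (hP.contMDiffAt (hopen.mem_nhds hz))).contDiffAt)
      (hGpos z hz)).contDiffWithinAt
  have hDW : ∀ z ∈ χ.target, mfderiv 𝓘(ℝ, Euc n) (𝓡 n) χ.symm z (W z) = gradient g f (χ.symm z) := by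
    intro z hz
    refine eq_gradient_iff g f _ _ fun w => ?_
    obtain ⟨w', rfl⟩ := (hinv z hz).surjective w
    have h := apply_inverse_of_isInvertible (isInvertible_of_forall_pos (hGpos z hz))
      (fderiv ℝ (f ∘ χ.symm) z)
    exact (congrArg (fun L : Euc n →L[ℝ] ℝ => L w') h).trans
      (differential_mfderiv hf (hPd z hz) w').symm
  have hc : ContDiffOn ℝ ∞ (fun z => (formInChart φ x₀ z).curryLeft) χ.target := fun z hz =>
    ContDiffWithinAt.comp (G := Euc n →L[ℝ] Euc n [⋀^Fin q]→L[ℝ] ℝ) z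
      (g := (ContinuousAlternatingMap.curryLeftLI (𝕜 := ℝ) (E := Euc n) (F := ℝ)
        (n := q)).toContinuousLinearMap) (ContinuousLinearMap.contDiff _).contDiffWithinAt
      (hφ x₀ z hz) (Set.mapsTo_univ _ _)
  refine (hc.clm_apply hWsm).congr fun z hz => ?_
  ext v
  let φf : (Euc n) [⋀^Fin (q + 1)]→L[ℝ] ℝ := φ (χ.symm z)
  let D : Euc n →L[ℝ] Euc n := mfderiv 𝓘(ℝ, Euc n) (𝓡 n) χ.symm z
  have h1 : D (W z) = gradient g f (χ.symm z) := hDW z hz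
  show φf (Fin.cons (gradient g f (χ.symm z)) (fun i => D (v i))) =
    φf (fun i => D (Matrix.vecCons (W z) v i))
  rw [← h1]
  refine congrArg φf (funext fun i => ?_)
  refine Fin.cases rfl (fun j => rfl) i

/-! ### Uniform size and ellipticity of orthonormal frames -/

section FrameBounds

/-- A frame that is orthonormal for an inner product `H` with `c ‖v‖² ≤ H(v, v)` is bounded. -/
theorem norm_le_of_orthonormalFor {E : Type*} [NormedAddCommGroup E] [NormedSpace ℝ E]
    {H : E →L[ℝ] E →L[ℝ] ℝ} {c : ℝ} (hc : 0 < c) (hH : ∀ v, c * ‖v‖ ^ 2 ≤ H v v) {v : E}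
    (hv : H v v = 1) : ‖v‖ ≤ (√c)⁻¹ := by
  have h1 := hH v
  rw [hv] at h1
  have hs : 0 < √c := Real.sqrt_pos.2 hc
  rw [← one_div, le_div_iff₀ hs]
  have h2 : (‖v‖ * √c) ^ 2 ≤ 1 ^ 2 := by
    rw [mul_pow, Real.sq_sqrt hc.le]; linarith
  exact le_of_sq_le_sq h2 zero_le_one

variable {E : Type*} [NormedAddCommGroup E] [InnerProductSpace ℝ E] {ι : Type*} [Fintype ι]

/-- A bounded frame that is orthonormal for a bounded inner product is uniformly elliptic. -/
theorem mul_norm_sq_le_sum_inner_sq {H : E →L[ℝ] E →L[ℝ] ℝ} {K L : ℝ} (hK : ‖H‖ ≤ K)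
    {e : ι → E} (he : ∀ i, ‖e i‖ ≤ L) (hsum : ∀ v, ∑ i, H v (e i) • e i = v) (ξ : E) :
    (Fintype.card ι * (K * L) ^ 2 + 1)⁻¹ * ‖ξ‖ ^ 2 ≤ ∑ i, inner ℝ (e i) ξ ^ 2 := by
  by_cases hξ : ξ = 0
  · simp [hξ]
  have hξn : 0 < ‖ξ‖ := norm_pos_iff.2 hξ
  set S := ∑ i, inner ℝ (e i) ξ ^ 2 with hS
  have hS0 : 0 ≤ S := Finset.sum_nonneg fun i _ => sq_nonneg _
  set m : ℝ := Fintype.card ι * (K * L) ^ 2 with hm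
  have hm0 : 0 ≤ m := by positivity
  -- One factor `ξ` is expanded in the frame. Cauchy–Schwarz and `|H(ξ, eᵢ)| ≤ K L ‖ξ‖` then give
  -- `‖ξ‖² ≤ m S`.
  have h1 : ‖ξ‖ ^ 2 = ∑ i, H ξ (e i) * inner ℝ (e i) ξ := by
    rw [← real_inner_self_eq_norm_sq]
    conv_lhs => enter [2]; rw [← hsum ξ]
    simp [sum_inner, inner_smul_left]
  have h2 : (‖ξ‖ ^ 2) ^ 2 ≤ (∑ i, H ξ (e i) ^ 2) * S := by
    rw [h1]; exact Finset.sum_mul_sq_le_sq_mul_sq _ _ _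
  have h3 : ∑ i, H ξ (e i) ^ 2 ≤ m * ‖ξ‖ ^ 2 := by
    calc ∑ i, H ξ (e i) ^ 2 ≤ ∑ _i : ι, (K * L) ^ 2 * ‖ξ‖ ^ 2 := by
          refine Finset.sum_le_sum fun i _ => ?_
          rw [← mul_pow, ← sq_abs]
          refine pow_le_pow_left₀ (abs_nonneg _) ?_ 2
          calc |H ξ (e i)| ≤ ‖H‖ * ‖ξ‖ * ‖e i‖ := H.le_opNorm₂ _ _
            _ ≤ K * ‖ξ‖ * L := by
                have := (norm_nonneg H).trans hK
                gcongr
                exact he i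
            _ = K * L * ‖ξ‖ := by ring
      _ = m * ‖ξ‖ ^ 2 := by rw [hm]; simp; ring
  have h4 : ‖ξ‖ ^ 2 * ‖ξ‖ ^ 2 ≤ (m * S) * ‖ξ‖ ^ 2 := by
    have := mul_le_mul_of_nonneg_right h3 hS0
    nlinarith
  have h5 : ‖ξ‖ ^ 2 ≤ m * S := le_of_mul_le_mul_right h4 (by positivity)
  rw [inv_mul_le_iff₀ (by positivity)]
  linarith

end FrameBounds

/-! ### Bounding the lower order terms by the gradient -/

section SecondOrder

variable {E : Type*} [NormedAddCommGroup E] [NormedSpace ℝ E] {q : ℕ}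

theorem abs_apply_removeNth_le (a : E [⋀^Fin q]→L[ℝ] ℝ) {e : Fin (q + 1) → E} {L : ℝ}
    (he : ∀ i, ‖e i‖ ≤ L) (i : Fin (q + 1)) : |a (i.removeNth e)| ≤ ‖a‖ * L ^ q := by
  refine (a.le_opNorm _).trans ?_
  gcongr
  calc ∏ j, ‖i.removeNth e j‖ ≤ ∏ _j : Fin q, L :=
        Finset.prod_le_prod (fun j _ => norm_nonneg _) fun j _ => he _
    _ = L ^ q := by simp

/-- Every term left after the identity for `∑ D²u(eᵢ, eᵢ)` is linear in `du` or in the gradient `w`,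
and `w = ∑ du(eᵢ) eᵢ` is itself controlled by `du`. -/
theorem abs_sum_fderiv_fderiv_le {u : E → ℝ} {H : E → E →L[ℝ] E →L[ℝ] ℝ}
    {Φ : E → E [⋀^Fin (q + 1)]→L[ℝ] ℝ} {w : E → E} {y : E}
    (hH : DifferentiableAt ℝ H y) (hΦ : DifferentiableAt ℝ Φ y) (hw : DifferentiableAt ℝ w y)
    (hHw : ∀ᶠ z in 𝓝 y, H z (w z) = fderiv ℝ u z) {e : Fin (q + 1) → E}
    (hcal : ∀ i v, Φ y (Function.update e i v) = H y v (e i))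
    (hsum : ∀ v, ∑ i, H y v (e i) • e i = v) {a : E [⋀^Fin q]→L[ℝ] ℝ}
    (ha : extDeriv (fun z => (Φ z).curryLeft (w z)) y e =
      ∑ i : Fin (q + 1), (-1 : ℝ) ^ (i : ℕ) * (fderiv ℝ u y (e i) * a (i.removeNth e)))
    {K L : ℝ} (he : ∀ i, ‖e i‖ ≤ L) (hK₁ : ‖fderiv ℝ H y‖ ≤ K) (hK₂ : ‖fderiv ℝ Φ y‖ ≤ K)
    (hK₃ : ‖a‖ ≤ K) :
    |∑ i, fderiv ℝ (fderiv ℝ u) y (e i) (e i)| ≤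
      (q + 1) * (L * K * L ^ q + (K * L * ((q + 1) * L ^ 2) * L + K * L * ((q + 1) * L ^ 2) * L ^ q)) *
        ‖fderiv ℝ u y‖ := by
  set d := ‖fderiv ℝ u y‖ with hd
  have hL0 : 0 ≤ L := (norm_nonneg _).trans (he 0)
  have hK0 : 0 ≤ K := (norm_nonneg _).trans hK₃
  have hdu : ∀ i, |fderiv ℝ u y (e i)| ≤ d * L := fun i =>
    ((fderiv ℝ u y).le_opNorm _).trans (by gcongr; exact he i)
  have hwn : ‖w y‖ ≤ (q + 1) * L ^ 2 * d := by
    have h1 : w y = ∑ i, fderiv ℝ u y (e i) • e i := by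
      rw [← hHw.self_of_nhds, hsum]
    rw [h1]
    refine (norm_sum_le _ _).trans ?_
    calc ∑ i, ‖fderiv ℝ u y (e i) • e i‖ ≤ ∑ _i : Fin (q + 1), d * L * L := by
          refine Finset.sum_le_sum fun i _ => ?_
          rw [norm_smul, Real.norm_eq_abs]
          gcongr
          exacts [hdu i, he i]
      _ = (q + 1) * L ^ 2 * d := by simp; ring
  have hsign : ∀ i : Fin (q + 1), |(-1 : ℝ) ^ (i : ℕ)| = 1 := fun i => by simp
  rw [sum_fderiv_fderiv_eq hH hΦ hw hHw hcal, ha, ← Finset.sum_add_distrib]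
  refine (Finset.abs_sum_le_sum_abs _ _).trans ?_
  have hterm : ∀ i : Fin (q + 1),
      |(-1 : ℝ) ^ (i : ℕ) * (fderiv ℝ u y (e i) * a (i.removeNth e)) +
        (fderiv ℝ H y (e i) (w y) (e i) - (-1 : ℝ) ^ (i : ℕ) *
          (fderiv ℝ Φ y (e i)).curryLeft (w y) (i.removeNth e))| ≤
      d * L * (K * L ^ q) + (K * L * ((q + 1) * L ^ 2 * d) * L +
        K * L * ((q + 1) * L ^ 2 * d) * L ^ q) := by
    intro i
    refine (abs_add_le _ _).trans (add_le_add ?_ ((abs_sub _ _).trans (add_le_add ?_ ?_)))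
    · rw [abs_mul, hsign, one_mul, abs_mul]
      refine mul_le_mul (hdu i) ((abs_apply_removeNth_le a he i).trans ?_) (abs_nonneg _)
        (by positivity)
      gcongr
    · refine ((fderiv ℝ H y (e i)).le_opNorm₂ _ _).trans ?_
      gcongr
      · exact ((fderiv ℝ H y).le_opNorm _).trans (by gcongr; exact he i)
      · exact he i
    · rw [abs_mul, hsign, one_mul]
      refine (abs_apply_removeNth_le _ he i).trans ?_
      gcongr
      refine ((fderiv ℝ Φ y (e i)).curryLeft.le_opNorm _).trans ?_
      rw [ContinuousAlternatingMap.norm_curryLeft]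
      gcongr
      exact ((fderiv ℝ Φ y).le_opNorm _).trans (by gcongr; exact he i)
  refine (Finset.sum_le_sum fun i _ => hterm i).trans (le_of_eq ?_)
  simp
  ring

end SecondOrder

/-! ### The elliptic inequality and the maximum principle on a parametrized piece -/

section Local

variable {n : ℕ} {X : Type*} [TopologicalSpace X] [ChartedSpace (Euc n) X]
  [IsManifold (𝓡 n) ∞ X]
  {E : Type*} [NormedAddCommGroup E] [InnerProductSpace ℝ E] [FiniteDimensional ℝ E]

/-- Strict differentiability at one point makes `h` Lipschitz nearby, and the Lipschitz constant
bounds the derivative at all nearby points. -/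
theorem exists_eventually_norm_fderiv_le {F G : Type*} [NormedAddCommGroup F]
    [NormedSpace ℝ F] [NormedAddCommGroup G] [NormedSpace ℝ G] {h : F → G} {h' : F →L[ℝ] G} {y : F}
    (hh : HasStrictFDerivAt h h' y) : ∃ K, ∀ᶠ z in 𝓝 y, ‖fderiv ℝ h z‖ ≤ K := by
  obtain ⟨K, s, hs, hK⟩ := hh.exists_lipschitzOnWith
  refine ⟨K, ?_⟩
  filter_upwards [eventually_mem_nhds_iff.2 hs] with z hz
  exact norm_fderiv_le_of_lipschitzOn ℝ hz hK

theorem metricForm_comass {g : Metric n X} {p : ℕ} {φ : Form n X p} (hφ : IsCalibration g φ) (x : X)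
    (v : Fin p → TangentSpace (𝓡 n) x) (hv : OrthonormalFor (metricForm g x) v) :
    (φ x).toAlternatingMap v ≤ 1 :=
  hφ.comass_le x v hv

/-- On a piece of a `φ`-submanifold, parametrized by an open subset of a Euclidean space, a function
that is pluriharmonic mod `d` satisfies a second order elliptic differential inequality. -/
theorem exists_elliptic_inequality {q : ℕ} {g : Metric n X} {φ : Form n X (q + 1)}
    (hφ : IsCalibration g φ) {f : X → ℝ} (hf : IsPluriharmonicModD g φ f)
    (hE : q + 1 = Module.finrank ℝ E) {P : E → X} {U : Set E} (hU : IsOpen U)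
    (hP : ContMDiffOn 𝓘(ℝ, E) (𝓡 n) ∞ P U)
    (hframe : ∀ y ∈ U, ∃ e : Fin (q + 1) → E,
      IsPhiPlane g φ (P y) fun i => mfderiv 𝓘(ℝ, E) (𝓡 n) P y (e i))
    {y₀ : E} (hy₀ : y₀ ∈ U) :
    ∃ l L C : ℝ, 0 < l ∧ 0 ≤ C ∧ ∀ᶠ y in 𝓝 y₀, ∃ e : Fin (q + 1) → E, (∀ i, ‖e i‖ ≤ L) ∧
      (∀ ξ : E, l * ‖ξ‖ ^ 2 ≤ ∑ i, inner ℝ (e i) ξ ^ 2) ∧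
      |∑ i, fderiv ℝ (fderiv ℝ (f ∘ P)) y (e i) (e i)| ≤ C * ‖fderiv ℝ (f ∘ P) y‖ := by
  obtain ⟨hfs, α, σ, hα, -, hσ, hfασ⟩ := hf
  have hPat : ∀ y ∈ U, ContMDiffAt 𝓘(ℝ, E) (𝓡 n) ∞ P y := fun y hy =>
    hP.contMDiffAt (hU.mem_nhds hy)
  have hPd : ∀ y ∈ U, MDifferentiableAt 𝓘(ℝ, E) (𝓡 n) P y := fun y hy =>
    (hPat y hy).mdifferentiableAt (by simp)
  set H := pullMetric g P with hHdef
  set Φ := pullForm P φ with hΦdef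
  set u := f ∘ P with hu
  have hHC : ∀ y ∈ U, ContDiffAt ℝ ∞ H y := fun y hy =>
    (contDiffOn_pullMetric g hU hP).contDiffAt (hU.mem_nhds hy)
  have huC : ∀ y ∈ U, ContDiffAt ℝ ∞ u y := fun y hy =>
    (hfs.contMDiffAt.comp y (hPat y hy)).contDiffAt
  -- expansion in the frame, and consequences
  have hsum : ∀ y, ∀ e : Fin (q + 1) → E,
      (∀ i j, H y (e i) (e j) = if i = j then 1 else 0) →
      ∀ v, ∑ i, H y v (e i) • e i = v := fun y e he v => by
    let B : LinearMap.BilinForm ℝ E :=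
      { toFun := fun v => (H y v : E →ₗ[ℝ] ℝ)
        map_add' := fun v w => by ext; simp
        map_smul' := fun c v => by ext; simp }
    exact OrthonormalFor.sum_smul_eq (B := B) he hE v
  -- The frame makes `P` an immersion: if `dP(v) = 0`, all coefficients `H(v, eᵢ)` of `v` vanish.
  have hHpos : ∀ y ∈ U, ∀ v, v ≠ 0 → 0 < H y v v := fun y hy v hv => by
    obtain ⟨e, he, -⟩ := hframe y hy
    refine g.pos _ _ fun h0 => hv ?_
    rw [← hsum y e he v]
    refine Finset.sum_eq_zero fun i _ => ?_
    have h1 : H y v (e i) = 0 :=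
      LinearMap.congr_fun ((congrArg (metricForm g (P y)) h0).trans (map_zero _))
        (mfderiv 𝓘(ℝ, E) (𝓡 n) P y (e i))
    rw [h1, zero_smul]
  -- The gradient of `u` for the induced metric, representing the tangential part of `∇f`.
  let w : E → E := fun z => (H z).inverse (fderiv ℝ u z)
  have hwC : ∀ y ∈ U, ContDiffAt ℝ ∞ w y := fun y hy =>
    contDiffAt_inverse_fderiv (hHC y hy) (huC y hy) (hHpos y hy)
  have hHw : ∀ y ∈ U, H y (w y) = fderiv ℝ u y := fun y hy =>
    apply_inverse_of_isInvertible (isInvertible_of_forall_pos (hHpos y hy)) _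
  have hdPhi : ∀ y ∈ U, pullForm P (dPhi g φ f) y = (Φ y).curryLeft (w y) := fun y hy => by
    obtain ⟨e, he, heφ⟩ := hframe y hy
    ext t
    let D₀ : E →L[ℝ] TangentSpace (𝓡 n) (P y) := mfderiv 𝓘(ℝ, E) (𝓡 n) P y
    let D : E →ₗ[ℝ] TangentSpace (𝓡 n) (P y) := D₀
    have h := map_cons_eq_of_tangential (B := metricForm g (P y)) (g.symm (P y)) (g.pos (P y))
      (metricForm_comass hφ (P y)) D hE (e := e) he heφ (v := gradient g f (P y)) (w := w y)
      (fun x => ?_) t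
    · refine h.trans ?_
      let φf : (Euc n) [⋀^Fin (q + 1)]→L[ℝ] ℝ := φ (P y)
      let D' : E →L[ℝ] Euc n := mfderiv 𝓘(ℝ, E) (𝓡 n) P y
      show φf (Fin.cons (D' (w y)) (fun i => D' (t i))) = φf (fun i => D' (Matrix.vecCons (w y) t i))
      refine congrArg φf (funext fun i => ?_)
      exact Fin.cases rfl (fun j => rfl) i
    · have h1 : metricForm g (P y) (gradient g f (P y)) (D x) = fderiv ℝ u y x :=
        (inner_gradient g f (P y) (D x)).trans (differential_mfderiv hfs (hPd y hy) x)
      rw [h1, ← hHw y hy]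
      rfl
  -- local bounds
  obtain ⟨c, hc, hcoer⟩ := exists_eventually_coercive (hHC y₀ hy₀).continuousAt (hHpos y₀ hy₀)
  obtain ⟨K₁, hK₁⟩ := exists_eventually_norm_fderiv_le
    ((hHC y₀ hy₀).hasStrictFDerivAt (by simp))
  obtain ⟨Φ', hΦ'⟩ := exists_hasStrictFDerivAt_pullForm hφ.smooth (hPat y₀ hy₀)
  obtain ⟨K₂, hK₂⟩ := exists_eventually_norm_fderiv_le hΦ'
  obtain ⟨A', hA'⟩ := exists_hasStrictFDerivAt_pullForm hα (hPat y₀ hy₀)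
  have hK₃ : ∀ᶠ y in 𝓝 y₀, ‖pullForm P α y‖ < ‖pullForm P α y₀‖ + 1 :=
    hA'.continuousAt.norm.eventually_lt_const (lt_add_one _)
  have hK₄ : ∀ᶠ y in 𝓝 y₀, ‖H y‖ < ‖H y₀‖ + 1 :=
    (hHC y₀ hy₀).continuousAt.norm.eventually_lt_const (lt_add_one _)
  set K := max (max K₁ K₂) (‖pullForm P α y₀‖ + 1) with hK
  have hK0 : 0 ≤ K := le_max_of_le_right (by positivity)
  set L := (√c)⁻¹ with hL
  have hL0 : 0 ≤ L := by positivity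
  refine ⟨(Fintype.card (Fin (q + 1)) * ((‖H y₀‖ + 1) * L) ^ 2 + 1)⁻¹, L, (q + 1) * (L * K * L ^ q +
    (K * L * ((q + 1) * L ^ 2) * L + K * L * ((q + 1) * L ^ 2) * L ^ q)), by positivity,
    by positivity, ?_⟩
  · filter_upwards [hU.mem_nhds hy₀, hcoer, hK₁, hK₂, hK₃, hK₄] with y hy h1 h2 h3 h4 h5
    obtain ⟨e, he, heφ⟩ := hframe y hy
    have heL : ∀ i, ‖e i‖ ≤ L := fun i =>
      norm_le_of_orthonormalFor hc h1 ((he i i).trans (if_pos rfl))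
    refine ⟨e, heL, mul_norm_sq_le_sum_inner_sq h5.le heL (hsum y e he), ?_⟩
    obtain ⟨Φy, hΦy⟩ := exists_hasStrictFDerivAt_pullForm hφ.smooth (hPat y hy)
    refine abs_sum_fderiv_fderiv_le (a := pullForm P α y) ((hHC y hy).differentiableAt (by simp))
      hΦy.hasFDerivAt.differentiableAt ((hwC y hy).differentiableAt (by simp))
      (Filter.mem_of_superset (hU.mem_nhds hy) hHw) (fun i v => ?_) (hsum y e he) ?_ heL
      (h2.trans ((le_max_left _ _).trans (le_max_left _ _)))
      (h3.trans ((le_max_right _ _).trans (le_max_left _ _))) (h4.le.trans (le_max_right _ _))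
    · have h := map_update_eq_inner (B := metricForm g (P y)) (g.symm (P y)) (g.pos (P y))
        (metricForm_comass hφ (P y)) he heφ i (mfderiv 𝓘(ℝ, E) (𝓡 n) P y v)
      refine Eq.trans ?_ h
      let φf : (Euc n) [⋀^Fin (q + 1)]→L[ℝ] ℝ := φ (P y)
      let D' : E →L[ℝ] Euc n := mfderiv 𝓘(ℝ, E) (𝓡 n) P y
      show φf (D' ∘ Function.update e i v) = φf (Function.update (D' ∘ e) i (D' v))
      rw [Function.comp_update]
    · have heq : (fun z => (Φ z).curryLeft (w z)) =ᶠ[𝓝 y] pullForm P (dPhi g φ f) :=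
        Filter.mem_of_superset (hU.mem_nhds hy) fun z hz => (hdPhi z hz).symm
      rw [heq.extDeriv_eq, extDeriv_pullForm (hφ.smooth.dPhi g hfs) (hPat y hy), hfασ]
      -- The frame spans a `φ`-plane, so only `df ∧ α` survives in `dd^φ f`.
      have hσ0 := hσ (P y) _ ⟨he, heφ⟩
      have hdW := dWedge_apply f α (P y) fun i => mfderiv 𝓘(ℝ, E) (𝓡 n) P y (e i)
      refine Eq.trans ((congrArg₂ (· + ·) hdW hσ0).trans (add_zero _)) ?_
      refine Finset.sum_congr rfl fun i _ => ?_
      rw [← differential_mfderiv hfs (hPd y hy)]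
      rfl

/-- **Strong maximum principle** along a piece of a `φ`-submanifold. -/
theorem eventually_eq_of_isLocalExtr {q : ℕ} {g : Metric n X} {φ : Form n X (q + 1)}
    (hφ : IsCalibration g φ) {f : X → ℝ} (hf : IsPluriharmonicModD g φ f)
    (hE : q + 1 = Module.finrank ℝ E) {P : E → X} {U : Set E} (hU : IsOpen U)
    (hP : ContMDiffOn 𝓘(ℝ, E) (𝓡 n) ∞ P U)
    (hframe : ∀ y ∈ U, ∃ e : Fin (q + 1) → E,
      IsPhiPlane g φ (P y) fun i => mfderiv 𝓘(ℝ, E) (𝓡 n) P y (e i))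
    {y₀ : E} (hy₀ : y₀ ∈ U) (hext : IsLocalExtr (f ∘ P) y₀) :
    ∀ᶠ y in 𝓝 y₀, f (P y) = f (P y₀) := by
  obtain ⟨l, L, C, hl, hC, hell⟩ := exists_elliptic_inequality hφ hf hE hU hP hframe hy₀
  have hu : ∀ y ∈ U, ContDiffAt ℝ 2 (f ∘ P) y := fun y hy =>
    ((hf.1.contMDiffAt.comp y (hP.contMDiffAt (hU.mem_nhds hy))).contDiffAt).of_le
      (WithTop.coe_le_coe.2 (le_top : (2 : ℕ∞) ≤ ⊤))
  rcases hext with hmin | hmax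
  · obtain ⟨R, hR, hball⟩ := Metric.eventually_nhds_iff_ball.1
      (hell.and ((hU.eventually_mem hy₀).and hmin))
    filter_upwards [Metric.ball_mem_nhds y₀ (half_pos hR)] with y hy
    have := eq_of_isMax_of_elliptic (ι := Fin (q + 1)) (L := L) (u := -(f ∘ P)) hR hl hC
      (fun z hz => (hu z (hball z hz).2.1).neg.contDiffWithinAt) (fun z hz => ?_)
      (fun z hz => neg_le_neg (hball z hz).2.2) y hy
    · exact neg_injective this
    -- The upper half of the two-sided bound is the required inequality for `-u`.
    · obtain ⟨e, he1, he2, he3⟩ := (hball z hz).1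
      refine ⟨e, he1, he2, ?_⟩
      have h1 : fderiv ℝ (-(f ∘ P)) = -fderiv ℝ (f ∘ P) := funext fun x => fderiv_neg
      rw [h1, fderiv_neg]
      simp only [neg_apply, Pi.neg_apply, norm_neg, Finset.sum_neg_distrib]
      exact neg_le_neg (abs_le.1 he3).2
  · obtain ⟨R, hR, hball⟩ := Metric.eventually_nhds_iff_ball.1
      (hell.and ((hU.eventually_mem hy₀).and hmax))
    filter_upwards [Metric.ball_mem_nhds y₀ (half_pos hR)] with y hy
    refine eq_of_isMax_of_elliptic (ι := Fin (q + 1)) (L := L) (u := f ∘ P) hR hl hC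
      (fun z hz => (hu z (hball z hz).2.1).contDiffWithinAt) (fun z hz => ?_)
      (fun z hz => (hball z hz).2.2) y hy
    obtain ⟨e, he1, he2, he3⟩ := (hball z hz).1
    exact ⟨e, he1, he2, (abs_le.1 he3).1⟩

end Local

/-- Let `u` be continuous on a compact space and locally constant near each local maximum off `B`.
If `B` meets every component, then `u` is bounded by its values on `B`. -/
theorem exists_le_of_strong_maximum_principle {M : Type*} [TopologicalSpace M] [CompactSpace M]
    {u : M → ℝ} (hu : Continuous u) {B : Set M}
    (hB : ∀ x : M, (connectedComponent x ∩ B).Nonempty)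
    (hconn : ∀ m ∉ B, ∀ᶠ z in 𝓝 m, z ∈ connectedComponent m)
    (hmax : ∀ m ∉ B, IsLocalMax u m → ∀ᶠ z in 𝓝 m, u z = u m) (x : M) :
    ∃ b ∈ B, u x ≤ u b := by
  obtain ⟨m, hm, hmm⟩ := isClosed_connectedComponent.isCompact.exists_isMaxOn
    ⟨x, mem_connectedComponent⟩ hu.continuousOn (s := connectedComponent x)
  by_contra! hcon
  -- If `u x` exceeds every value on `B`, the maximum set `K` of the component avoids `B`. It is
  -- then open as well as closed.
  set K := connectedComponent x ∩ u ⁻¹' {u m} with hK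
  have hKB : ∀ z ∈ K, z ∉ B := fun z hz hzB => by
    have h1 := hcon z hzB
    have h2 : u x ≤ u m := hmm mem_connectedComponent
    have h3 : u z = u m := hz.2
    linarith
  have hKclosed : IsClosed K :=
    isClosed_connectedComponent.inter (isClosed_singleton.preimage hu)
  have hKopen : IsOpen K := by
    rw [isOpen_iff_mem_nhds]
    intro z hz
    have hzx : connectedComponent z = connectedComponent x := (connectedComponent_eq hz.1).symm
    have h1 := hconn z (hKB z hz)
    rw [hzx] at h1
    -- A maximum over the component is a local maximum in `M`, because the component is a
    -- neighbourhood of each of its points off `B`.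
    have hloc : IsLocalMax u z := by
      filter_upwards [h1] with z' hz'
      rw [show u z = u m from hz.2]
      exact hmm hz'
    filter_upwards [h1, hmax z (hKB z hz) hloc] with z' h2 h3
    exact ⟨h2, h3.trans hz.2⟩
  have hsub : connectedComponent m ⊆ K :=
    IsClopen.connectedComponent_subset ⟨hKclosed, hKopen⟩ ⟨hm, rfl⟩
  obtain ⟨b, hb, hbB⟩ := hB m
  exact hKB b (hsub hb) hbB

/-! ### Interior points of the submanifold in charts -/

section Submanifold

variable {n q : ℕ} {X : Type*} [TopologicalSpace X] [ChartedSpace (Euc n) X]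
  [IsManifold (𝓡 n) ∞ X] {M : Type*} [TopologicalSpace M]
  [ChartedSpace (EuclideanHalfSpace (q + 1)) M]

/-- A small ball in the chart target has a connected image around `m`. -/
theorem eventually_mem_connectedComponent_of_isInteriorPoint {m : M}
    (hm : (𝓡∂ (q + 1)).IsInteriorPoint m) : ∀ᶠ z in 𝓝 m, z ∈ connectedComponent m := by
  set ψ := extChartAt (𝓡∂ (q + 1)) m with hψ
  have hy₀ : ψ m ∈ interior ψ.target := ModelWithCorners.isInteriorPoint_iff.1 hm
  obtain ⟨r, hr, hball⟩ := Metric.isOpen_iff.1 isOpen_interior _ hy₀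
  have hpre : IsPreconnected (ψ.symm '' Metric.ball (ψ m) r) :=
    ((convex_ball _ _).isPreconnected).image _
      ((continuousOn_extChartAt_symm m).mono (hball.trans interior_subset))
  have hmem : m ∈ ψ.symm '' Metric.ball (ψ m) r :=
    ⟨ψ m, Metric.mem_ball_self hr, extChartAt_to_inv m⟩
  filter_upwards [extChartAt_source_mem_nhds (I := 𝓡∂ (q + 1)) m,
    (continuousAt_extChartAt (I := 𝓡∂ (q + 1)) m).preimage_mem_nhds (Metric.ball_mem_nhds _ hr)]
    with z hz hzb
  exact hpre.subset_connectedComponent hmem ⟨ψ z, hzb, ψ.left_inv hz⟩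

variable [IsManifold (𝓡∂ (q + 1)) ∞ M]

/-- A function that is pluriharmonic mod `d` is locally constant on a `φ`-submanifold near each
interior local extremum. -/
theorem eventually_eq_of_isLocalExtr_of_isInteriorPoint {g : Metric n X} {φ : Form n X (q + 1)}
    (hφ : IsCalibration g φ) {ι : M → X} (hι : IsPhiSubmanifold g φ ι) {f : X → ℝ}
    (hf : IsPluriharmonicModD g φ f) {m : M} (hm : (𝓡∂ (q + 1)).IsInteriorPoint m)
    (hext : IsLocalExtr (fun m => f (ι m)) m) : ∀ᶠ z in 𝓝 m, f (ι z) = f (ι m) := by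
  have : IsManifold (𝓡∂ (q + 1)) 1 M := IsManifold.of_le (n := ∞) (by simp)
  set ψ := extChartAt (𝓡∂ (q + 1)) m with hψ
  set U := interior ψ.target with hU
  have hy₀ : ψ m ∈ U := ModelWithCorners.isInteriorPoint_iff.1 hm
  have hleft : ψ.symm (ψ m) = m := extChartAt_to_inv m
  set P := ι ∘ ψ.symm with hPdef
  have hP : ContMDiffOn 𝓘(ℝ, EuclideanSpace ℝ (Fin (q + 1))) (𝓡 n) ∞ P U :=
    hι.isSmoothEmbedding.contMDiff.comp_contMDiffOn
      ((contMDiffOn_extChartAt_symm m).mono interior_subset)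
  -- All tangent spaces are copies of `Euc n`, so a frame can be moved between equal but not
  -- syntactically identical base points.
  have htrans : ∀ x x' : X, x = x' → ∀ v : Fin (q + 1) → Euc n,
      IsPhiPlane g φ x v → IsPhiPlane g φ x' v := by
    rintro x _ rfl v h
    exact h
  have hframe : ∀ y ∈ U, ∃ e : Fin (q + 1) → EuclideanSpace ℝ (Fin (q + 1)),
      IsPhiPlane g φ (P y) fun i =>
        mfderiv 𝓘(ℝ, EuclideanSpace ℝ (Fin (q + 1))) (𝓡 n) P y (e i) := by
    intro y hy
    -- Near `z` one has `ι = P ∘ ψ`, so `dψ` carries the given frame at `z` to one that `dP` maps to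
    -- the same `φ`-plane.
    obtain ⟨z, hz, rfl⟩ : ∃ z ∈ ψ.source, ψ z = y :=
      ⟨ψ.symm y, ψ.map_target (interior_subset hy), ψ.right_inv (interior_subset hy)⟩
    obtain ⟨e, he⟩ := hι.tangent z
    have hψd : MDifferentiableAt (𝓡∂ (q + 1)) 𝓘(ℝ, EuclideanSpace ℝ (Fin (q + 1))) ψ z :=
      mdifferentiableAt_extChartAt (by rwa [hψ, extChartAt_source] at hz)
    have hPd : MDifferentiableAt 𝓘(ℝ, EuclideanSpace ℝ (Fin (q + 1))) (𝓡 n) P (ψ z) :=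
      (hP.contMDiffAt (isOpen_interior.mem_nhds hy)).mdifferentiableAt (by simp)
    have heq : ι =ᶠ[𝓝 z] P ∘ ψ := by
      filter_upwards [(isOpen_extChartAt_source m).mem_nhds hz] with z' hz'
      exact congrArg ι (ψ.left_inv hz').symm
    have hd := ((hPd.hasMFDerivAt.comp z hψd.hasMFDerivAt).congr_of_eventuallyEq heq).mfderiv
    refine ⟨fun i => mfderiv (𝓡∂ (q + 1)) 𝓘(ℝ, EuclideanSpace ℝ (Fin (q + 1))) ψ z (e i), ?_⟩
    refine htrans (ι z) _ heq.self_of_nhds _ ?_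
    have hv : (fun i => mfderiv (𝓡∂ (q + 1)) (𝓡 n) ι z (e i)) = fun i =>
        (mfderiv 𝓘(ℝ, EuclideanSpace ℝ (Fin (q + 1))) (𝓡 n) P (ψ z)
          (mfderiv (𝓡∂ (q + 1)) 𝓘(ℝ, EuclideanSpace ℝ (Fin (q + 1))) ψ z (e i)) : Euc n) :=
      funext fun i => congrArg
        (fun T : EuclideanSpace ℝ (Fin (q + 1)) →L[ℝ] Euc n => T (e i)) hd
    exact hv ▸ he
  have htend : Filter.Tendsto ψ.symm (𝓝 (ψ m)) (𝓝 m) := by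
    have := (continuousOn_extChartAt_symm (I := 𝓡∂ (q + 1)) m).continuousAt
      (mem_interior_iff_mem_nhds.1 hy₀)
    rw [← hψ, ContinuousAt, hleft] at this
    exact this
  have hext' : IsLocalExtr (f ∘ P) (ψ m) := by
    have h0 : (f ∘ P) (ψ m) = f (ι m) := congrArg (fun z => f (ι z)) hleft
    rcases hext with h | h
    · left
      filter_upwards [htend.eventually h] with y hy
      rw [h0]; exact hy
    · right
      filter_upwards [htend.eventually h] with y hy
      rw [h0]; exact hy
  have hev := eventually_eq_of_isLocalExtr hφ hf (by simp) isOpen_interior hP hframe hy₀ hext'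
  filter_upwards [(continuousAt_extChartAt (I := 𝓡∂ (q + 1)) m).eventually hev,
    extChartAt_source_mem_nhds (I := 𝓡∂ (q + 1)) m] with z hz hzs
  have h1 : f (ι (ψ.symm (ψ z))) = f (ι (ψ.symm (ψ m))) := hz
  rwa [ψ.left_inv hzs, hleft] at h1

end Submanifold

end Calibrated

end

/-! ### The two bounds on the compact submanifold -/

theorem corollary5p5 {n q : ℕ}
    {X : Type*} [TopologicalSpace X] [T2Space X]
    [ChartedSpace (EuclideanSpace ℝ (Fin n)) X] [IsManifold (𝓡 n) ∞ X]
    (g : Calibrated.Metric n X) (φ : Calibrated.Form n X (q + 1))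
    (hφ : Calibrated.IsCalibration g φ)
    {M : Type*} [TopologicalSpace M] [CompactSpace M]
    [ChartedSpace (EuclideanHalfSpace (q + 1)) M] [IsManifold (𝓡∂ (q + 1)) ∞ M]
    (ι : M → X) (hι : Calibrated.IsPhiSubmanifold g φ ι)
    (hΓ : ∀ x : M, (connectedComponent x ∩ (𝓡∂ (q + 1)).boundary M).Nonempty)
    (f : X → ℝ) (hf : Calibrated.IsPluriharmonicModD g φ f) :
    BddBelow ((fun m => f (ι m)) '' (𝓡∂ (q + 1)).boundary M) ∧
    BddAbove ((fun m => f (ι m)) '' (𝓡∂ (q + 1)).boundary M) ∧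
    ∀ x : M, sInf ((fun m => f (ι m)) '' (𝓡∂ (q + 1)).boundary M) ≤ f (ι x) ∧
      f (ι x) ≤ sSup ((fun m => f (ι m)) '' (𝓡∂ (q + 1)).boundary M) := by
  set u : M → ℝ := fun m => f (ι m) with hu
  set Γ := (𝓡∂ (q + 1)).boundary M with hΓdef
  have hcont : Continuous u :=
    hf.1.continuous.comp hι.isSmoothEmbedding.isEmbedding.continuous
  have hint : ∀ m ∉ Γ, (𝓡∂ (q + 1)).IsInteriorPoint m := fun m hm =>
    ((𝓡∂ (q + 1)).isInteriorPoint_or_isBoundaryPoint m).resolve_right hm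
  have hbdd : Bornology.IsBounded (u '' Γ) :=
    (isCompact_range hcont).isBounded.subset (Set.image_subset_range _ _)
  have hle := Calibrated.exists_le_of_strong_maximum_principle hcont hΓ
    (fun m hm => Calibrated.eventually_mem_connectedComponent_of_isInteriorPoint (hint m hm))
    fun m hm hmax => Calibrated.eventually_eq_of_isLocalExtr_of_isInteriorPoint hφ hι hf
      (hint m hm) (Or.inr hmax)
  -- The lower bound is the upper bound for `-u`, whose local maxima are the local minima of `u`.
  have hge := Calibrated.exists_le_of_strong_maximum_principle hcont.neg hΓ
    (fun m hm => Calibrated.eventually_mem_connectedComponent_of_isInteriorPoint (hint m hm))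
    fun m hm hmax => (Calibrated.eventually_eq_of_isLocalExtr_of_isInteriorPoint hφ hι hf
      (hint m hm) (Or.inl (hmax.mono fun z hz => neg_le_neg_iff.1 hz))).mono
        fun z hz => congrArg Neg.neg hz
  refine ⟨hbdd.bddBelow, hbdd.bddAbove, fun x => ⟨?_, ?_⟩⟩
  · obtain ⟨b, hb, hxb⟩ := hge x
    exact (csInf_le hbdd.bddBelow ⟨b, hb, rfl⟩).trans (neg_le_neg_iff.1 hxb)
  · obtain ⟨b, hb, hxb⟩ := hle x
    exact hxb.trans (le_csSup hbdd.bddAbove ⟨b, hb, rfl⟩)
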